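/- Let $0<\beta<3$ and $\frac{3+\beta}{3}<p<\frac{3+\beta}{2}$. On $\mathbb{R}^3$ let $$I_\beta(x)=\frac{\Gamma\left(\frac{3-\beta}{2}\right)}{\Gamma(\beta/2)\,\pi^{3/2}\,2^{\beta}}\,\frac{1}{|x|^{3-\beta}},\qquad \mathcal{G}_\lambda(x)=\frac{e^{-\sqrt{\lambda}\,|x|}}{4\pi|x|}\quad(\lambda>0),$$ and, for a measurable function $u:\mathbb{R}^3\to\mathbb{C}$, let $$N(u)=\int_{\mathbb{R}^3}\left(I_\beta*|u|^p\right)|u|^p\in[0,\infty].$$ Let $\|\phi\|_{D^{1,2}}=\|\nabla\phi\|_{L^2}$ for $\phi\in H^1=H^1(\mathbb{R}^3;\mathbb{C})$, and let $$X=\{\phi+q\,\mathcal{G}_\lambda:\ \phi\in H^1,\ q\in\mathbb{C},\ \lambda>0\}\subset L^2(\mathbb{R}^3;\mathbb{C}).$$ Then there is a constant $K>0$, depending only on $\beta$ and $p$, such that for all $\phi\in H^1$, $q\in\mathbb{C}$ and $\lambda>0$ the function $u=\phi+q\,\mathcal{G}_\lambda\in X$ satisfies $$N(u)\le K\left(\|\phi\|_{D^{1,2}}^{3p-(3+\beta)}\|\phi\|_{L^2}^{3+\beta-p}+\|\phi\|_{D^{1,2}}^{\frac{3p-(3+\beta)}{2}}\|\phi\|_{L^2}^{\frac{3+\beta-p}{2}}\frac{|q|^p}{\lambda^{\frac{3+\beta-2p}{4}}}+\frac{|q|^{2p}}{\lambda^{\frac{3+\beta-2p}{2}}}\right)$$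 and $$N(u)\le K\left(\|\phi\|_{D^{1,2}}^{3p-(3+\beta)}\left(\|u\|_{L^2}^{3+\beta-p}+\frac{|q|^{3+\beta-p}}{\lambda^{\frac{3+\beta-p}{4}}}\right)+\|\phi\|_{D^{1,2}}^{\frac{3p-(3+\beta)}{2}}\left(\|u\|_{L^2}^{\frac{3+\beta-p}{2}}+\frac{|q|^{\frac{3+\beta-p}{2}}}{\lambda^{\frac{3+\beta-p}{8}}}\right)\frac{|q|^p}{\lambda^{\frac{3+\beta-2p}{4}}}+\frac{|q|^{2p}}{\lambda^{\frac{3+\beta-2p}{2}}}\right).$$ -/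

import Mathlib

open MeasureTheory
open scoped ContDiff

noncomputable section

namespace PointHartree

/-- Three-dimensional Euclidean space. -/
abbrev R3 : Type := EuclideanSpace ℝ (Fin 3)

/-- The Riesz potential `I_β` on `ℝ³`,
`I_β(x) = Γ((3 - β)/2) / (Γ(β/2) π^(3/2) 2^β) · |x|^(-(3 - β))`
(the value at the origin is irrelevant for the integrals below). -/
def rieszPotential (β : ℝ) (x : R3) : ℝ :=
  1 / (Real.Gamma (β / 2) * Real.pi ^ ((3 : ℝ) / 2) * (2 : ℝ) ^ β) *
    Real.Gamma ((3 - β) / 2) * (1 / ‖x‖ ^ (3 - β))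

/-- The fundamental solution `𝒢_lam` of `-Δ + lam` on `ℝ³`,
`𝒢_lam(x) = exp(-√lam |x|) / (4π|x|)`, for `lam > 0`
(the value at the origin is irrelevant, since functions are considered up to null sets). -/
def greenFn (lam : ℝ) (x : R3) : ℝ :=
  1 / (4 * Real.pi * ‖x‖) * Real.exp (-(Real.sqrt lam) * ‖x‖)

/-- The nonlocal functional `N(u) = ∫ (I_β ∗ |u|^p) |u|^p`. The integrands are nonnegative, and
`N(u)` is defined as an element of `[0, ∞]`, so that an upper bound by a real number includes the
finiteness of `N(u)`. -/
def nonlocalN (β p : ℝ) (u : R3 → ℂ) : ENNReal :=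
  ∫⁻ x : R3, (∫⁻ y : R3, ENNReal.ofReal (rieszPotential β (x - y)) *
    ENNReal.ofReal (‖u y‖ ^ p)) * ENNReal.ofReal (‖u x‖ ^ p)

/-- `g` is the weak gradient of `φ` on `ℝ³`: both are locally integrable and
`∫ φ ∂ᵢη = - ∫ gᵢ η` for every `i` and every real test function `η ∈ C_c^∞(ℝ³)`. -/
structure HasWeakGradient (φ : R3 → ℂ) (g : R3 → EuclideanSpace ℂ (Fin 3)) : Prop where
  locallyIntegrable : LocallyIntegrable φ volume
  locallyIntegrable_grad : LocallyIntegrable g volume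
  integral_eq : ∀ η : R3 → ℝ, ContDiff ℝ ∞ η → HasCompactSupport η → ∀ i : Fin 3,
    ∫ x, (fderiv ℝ η x (EuclideanSpace.single i 1)) • φ x = - ∫ x, η x • g x i

/-- The Sobolev space `H¹(ℝ³; ℂ)`: `φ ∈ L²` with a weak gradient in `L²`. -/
def MemH1 (φ : R3 → ℂ) : Prop :=
  MemLp φ 2 volume ∧
    ∃ g : R3 → EuclideanSpace ℂ (Fin 3), HasWeakGradient φ g ∧ MemLp g 2 volume

open Classical in
/-- The weak gradient of `φ` (unique up to null sets; `0` if there is none). -/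
def weakGradient (φ : R3 → ℂ) : R3 → EuclideanSpace ℂ (Fin 3) :=
  if h : ∃ g, HasWeakGradient φ g then h.choose else 0

/-- The `L²(ℝ³)` norm. -/
def normL2 {F : Type*} [NormedAddCommGroup F] (f : R3 → F) : ℝ :=
  (eLpNorm f 2 volume).toReal

/-- The `D^{1,2}` norm of a function `φ ∈ H¹`, that is, `‖∇φ‖_{L²} = (∫ |∇φ|²)^(1/2)`. -/
def normD12 (φ : R3 → ℂ) : ℝ :=
  normL2 (weakGradient φ)

/-- Weak gradients are unique up to null sets. -/
theorem HasWeakGradient.ae_eq {φ : R3 → ℂ} {g h : R3 → EuclideanSpace ℂ (Fin 3)}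
    (hg : HasWeakGradient φ g) (hh : HasWeakGradient φ h) : g =ᵐ[volume] h := by
  have key : ∀ i : Fin 3, ∀ᵐ x ∂(volume : Measure R3), g x i = h x i := by
    intro i
    have comp : ∀ {f : R3 → EuclideanSpace ℂ (Fin 3)}, LocallyIntegrable f volume →
        LocallyIntegrable (fun x => f x i) volume := by
      intro f hf x
      obtain ⟨s, hs, hfs⟩ := hf x
      exact ⟨s, hs, (EuclideanSpace.proj (𝕜 := ℂ) i).integrable_comp hfs⟩
    refine ae_eq_of_integral_contDiff_smul_eq (comp hg.locallyIntegrable_grad)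
      (comp hh.locallyIntegrable_grad) ?_
    intro η hη hc
    have h1 := hg.integral_eq η hη hc i
    have h2 := hh.integral_eq η hη hc i
    exact neg_injective (h1.symm.trans h2)
  filter_upwards [ae_all_iff.2 key] with x hx
  ext i
  exact hx i

/-- The `D^{1,2}` norm can be computed with any weak gradient. -/
theorem HasWeakGradient.normD12_eq {φ : R3 → ℂ} {g : R3 → EuclideanSpace ℂ (Fin 3)}
    (hg : HasWeakGradient φ g) : normD12 φ = normL2 g := by
  have h : ∃ g, HasWeakGradient φ g := ⟨g, hg⟩
  have hw : HasWeakGradient φ (weakGradient φ) := by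
    rw [weakGradient, dif_pos h]
    exact h.choose_spec
  rw [normD12, normL2, normL2, eLpNorm_congr_ae (hw.ae_eq hg)]

end PointHartree

end

/-! With h = |φ|^p + |q𝒢_λ|^p one has |u|^p ≤ 2^p h, so N(u) is at most a multiple of the Riesz form
of h with itself, and bilinearity leaves four terms. Put σ = (3+β)/6. The Hardy–Littlewood–Sobolev
inequality would bound each term by L^{1/σ} norms of the two entries. A softer estimate,
`exists_riesz_bilinear_le`, takes its place: cut the kernel at radius R, apply Young's inequality
(`lintegral_conv_mul_le`) to the two pieces with exponents σ - ε and σ + ε, and optimise over R.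
This gives the geometric mean of the bounds at σ - ε and σ + ε.

Nothing is lost in the powers. The bounds for |φ|^p (`exists_gagliardoNirenberg`, resting on
`exists_sobolev`) and for |q𝒢_λ|^p (`exists_lintegral_smul_greenFn`) are monomials whose exponents
are affine in σ, so ε cancels in the geometric mean.

The range of p enters through p/σ. The lower bound says p/σ > 2, so that L^{p/σ} lies between L² and
L⁶; the upper bound says p/σ < 3, which is when 𝒢_λ lies in L^{p/σ}. Strictness leaves room for ε.

The second bound follows from the first, because ‖𝒢_λ‖₂ is a multiple of λ^{-1/4} and therefore ‖φ‖₂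
is controlled by ‖u‖₂ + |q|λ^{-1/4} (`exists_normL2_le`). -/

namespace PointHartree

open scoped ENNReal
open Filter Topology

/-! ### Young's inequality -/

section Young

variable {G : Type*} [AddCommGroup G] [MeasurableSpace G] [MeasurableAdd₂ G] [MeasurableNeg G]

/-- Young's inequality for a convolution paired with a function of the same exponent. -/
theorem lintegral_conv_mul_le (μ : Measure G) [SFinite μ] [μ.IsAddLeftInvariant]
    [μ.IsNegInvariant] {f g k : G → ℝ≥0∞} (hf : Measurable f) (hg : Measurable g)
    (hk : Measurable k) {σ α : ℝ} (hα0 : 0 < α) (hα1 : α ≤ 1) (hασ : α + 2 * σ = 2) :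
    ∫⁻ x, (∫⁻ y, k (x - y) * f y ∂μ) * g x ∂μ ≤
      (∫⁻ x, k x ^ (1 / α) ∂μ) ^ α *
        ((∫⁻ x, f x ^ (1 / σ) ∂μ) ^ σ * (∫⁻ x, g x ^ (1 / σ) ∂μ) ^ σ) := by
  have hσ : 0 < σ := by linarith
  have hsub : Measurable fun z : G × G => z.1 - z.2 := by
    simp only [sub_eq_add_neg]; exact measurable_fst.add measurable_snd.neg
  have hkl : ∀ y, Measurable fun x => k (x - y) := fun y =>
    hk.comp (measurable_id.sub_const y)
  have hkr : ∀ x, Measurable fun y => k (x - y) := fun x =>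
    hk.comp (measurable_id.const_sub x)
  set F := ∫⁻ x, f x ^ (1 / σ) ∂μ
  set H := ∫⁻ x, g x ^ (1 / σ) ∂μ
  set κ := ∫⁻ x, k x ^ (1 / α) ∂μ
  -- Three-function Hölder on G × G: each `T i` pairs two of f, g, k, so its integral factorises by
  -- Tonelli and invariance of the measure. The weights are the ones that make the product of the `T
  -- i ^ w i` equal to the integrand.
  let w : Fin 3 → ℝ := ![1 - α, α / 2, α / 2]
  let T : Fin 3 → G × G → ℝ≥0∞ :=
    ![fun z => f z.2 ^ (1 / σ) * g z.1 ^ (1 / σ),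
      fun z => k (z.1 - z.2) ^ (1 / α) * f z.2 ^ (1 / σ),
      fun z => k (z.1 - z.2) ^ (1 / α) * g z.1 ^ (1 / σ)]
  have hT : ∀ i, Measurable (T i) := by
    intro i
    have h1 : Measurable fun z : G × G => f z.2 ^ (1 / σ) :=
      (hf.comp measurable_snd).pow_const _
    have h2 : Measurable fun z : G × G => g z.1 ^ (1 / σ) :=
      (hg.comp measurable_fst).pow_const _
    have h3 : Measurable fun z : G × G => k (z.1 - z.2) ^ (1 / α) :=
      (hk.comp hsub).pow_const _
    fin_cases i
    · exact h1.mul h2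
    · exact h3.mul h1
    · exact h3.mul h2
  have key := ENNReal.lintegral_prod_norm_pow_le (μ := μ.prod μ) Finset.univ (f := T) (p := w)
    (fun i _ => (hT i).aemeasurable) (by simp [w, Fin.sum_univ_three]; ring)
    (fun i _ => by fin_cases i <;> simp [w] <;> linarith)
  have e1 : 1 / σ * (1 - α) + 1 / σ * (α / 2) = 1 := by
    field_simp; linarith
  have e2 : 1 / α * (α / 2) + 1 / α * (α / 2) = 1 := by field_simp; norm_num
  have n1 : 0 ≤ 1 / σ * (1 - α) := mul_nonneg (by positivity) (by linarith)
  have n2 : 0 ≤ 1 / σ * (α / 2) := by positivity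
  have n3 : 0 ≤ 1 / α * (α / 2) := by positivity
  have hprod : ∀ z : G × G, ∏ i, T i z ^ w i = k (z.1 - z.2) * f z.2 * g z.1 := by
    intro z
    simp only [Fin.prod_univ_three, T, w, Matrix.cons_val_zero, Matrix.cons_val_one,
      Matrix.cons_val]
    rw [ENNReal.mul_rpow_of_nonneg _ _ (by linarith : 0 ≤ 1 - α),
      ENNReal.mul_rpow_of_nonneg _ _ (by linarith : 0 ≤ α / 2),
      ENNReal.mul_rpow_of_nonneg _ _ (by linarith : 0 ≤ α / 2)]
    simp only [← ENNReal.rpow_mul]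
    calc _ = (k (z.1 - z.2) ^ (1 / α * (α / 2)) * k (z.1 - z.2) ^ (1 / α * (α / 2))) *
          (f z.2 ^ (1 / σ * (1 - α)) * f z.2 ^ (1 / σ * (α / 2))) *
          (g z.1 ^ (1 / σ * (1 - α)) * g z.1 ^ (1 / σ * (α / 2))) := by ring
      _ = _ := by
        rw [← ENNReal.rpow_add_of_nonneg _ _ n3 n3, ← ENNReal.rpow_add_of_nonneg _ _ n1 n2,
          ← ENNReal.rpow_add_of_nonneg _ _ n1 n2, e1, e2]
        simp
  have I0 : ∫⁻ z, T 0 z ∂(μ.prod μ) = F * H := by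
    rw [lintegral_prod _ (hT 0).aemeasurable]
    simp only [T, Matrix.cons_val_zero]
    simp_rw [lintegral_mul_const _ (hf.pow_const (1 / σ))]
    rw [lintegral_const_mul _ (hg.pow_const (1 / σ))]
  have I1 : ∫⁻ z, T 1 z ∂(μ.prod μ) = κ * F := by
    rw [lintegral_prod_symm _ (hT 1).aemeasurable]
    simp only [T, Matrix.cons_val_one]
    have : ∀ y, ∫⁻ x, k (x - y) ^ (1 / α) * f y ^ (1 / σ) ∂μ = κ * f y ^ (1 / σ) := by
      intro y
      rw [lintegral_mul_const _ ((hkl y).pow_const _)]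
      congr 1
      exact lintegral_sub_right_eq_self (fun x => k x ^ (1 / α)) y
    simp only [Matrix.cons_val_zero, this]
    rw [lintegral_const_mul _ (hf.pow_const _)]
  have I2 : ∫⁻ z, T 2 z ∂(μ.prod μ) = κ * H := by
    rw [lintegral_prod _ (hT 2).aemeasurable]
    simp only [T, Matrix.cons_val]
    have : ∀ x, ∫⁻ y, k (x - y) ^ (1 / α) * g x ^ (1 / σ) ∂μ = κ * g x ^ (1 / σ) := by
      intro x
      rw [lintegral_mul_const _ ((hkr x).pow_const _)]
      congr 1
      exact lintegral_sub_left_eq_self (fun x => k x ^ (1 / α)) x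
    simp only [this]
    rw [lintegral_const_mul _ (hg.pow_const _)]
  have hm : Measurable fun z : G × G => k (z.1 - z.2) * f z.2 * g z.1 :=
    ((hk.comp hsub).mul (hf.comp measurable_snd)).mul (hg.comp measurable_fst)
  calc ∫⁻ x, (∫⁻ y, k (x - y) * f y ∂μ) * g x ∂μ
      = ∫⁻ z, k (z.1 - z.2) * f z.2 * g z.1 ∂(μ.prod μ) := by
        rw [lintegral_prod _ hm.aemeasurable]
        refine lintegral_congr fun x => ?_
        exact (lintegral_mul_const _ ((hkr x).mul hf)).symm
    _ = ∫⁻ z, ∏ i, T i z ^ w i ∂(μ.prod μ) := by simp_rw [hprod]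
    _ ≤ ∏ i, (∫⁻ z, T i z ∂(μ.prod μ)) ^ w i := key
    _ = κ ^ α * (F ^ σ * H ^ σ) := by
        rw [Fin.prod_univ_three, I0, I1, I2]
        simp only [w, Matrix.cons_val_zero, Matrix.cons_val_one, Matrix.cons_val]
        rw [ENNReal.mul_rpow_of_nonneg _ _ (by linarith : 0 ≤ 1 - α),
          ENNReal.mul_rpow_of_nonneg _ _ (by linarith : 0 ≤ α / 2),
          ENNReal.mul_rpow_of_nonneg _ _ (by linarith : 0 ≤ α / 2)]
        calc _ = (κ ^ (α / 2) * κ ^ (α / 2)) * ((F ^ (1 - α) * F ^ (α / 2)) *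
              (H ^ (1 - α) * H ^ (α / 2))) := by ring
          _ = _ := by
            rw [← ENNReal.rpow_add_of_nonneg _ _ (by linarith) (by linarith),
              ← ENNReal.rpow_add_of_nonneg _ _ (by linarith) (by linarith),
              ← ENNReal.rpow_add_of_nonneg _ _ (by linarith) (by linarith)]
            congr 2 <;> congr 1 <;> linarith

end Young

/-! ### The Riesz form by truncation of the kernel -/

/-- Optimising `t X + t⁻¹ Y` over `t > 0`. -/
theorem le_two_mul_sqrt_of_forall_le {z : ℝ≥0∞} {x y : ℝ} (hx : 0 ≤ x) (hy : 0 ≤ y)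
    (h : ∀ t : ℝ, 0 < t → z ≤ ENNReal.ofReal (t * x + t⁻¹ * y)) :
    z ≤ ENNReal.ofReal (2 * √(x * y)) := by
  -- The minimiser t = √(y/x) degenerates when x or y vanishes, so both are shifted by δ > 0 and δ
  -- tends to 0.
  have hlim : Tendsto (fun δ : ℝ => ENNReal.ofReal (2 * √((x + δ) * (y + δ)))) (𝓝[>] 0)
      (𝓝 (ENNReal.ofReal (2 * √((x + 0) * (y + 0))))) := by
    refine Tendsto.mono_left ?_ nhdsWithin_le_nhds
    have : Continuous fun δ : ℝ => ENNReal.ofReal (2 * √((x + δ) * (y + δ))) :=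
      ENNReal.continuous_ofReal.comp (by fun_prop)
    exact this.tendsto 0
  rw [add_zero, add_zero] at hlim
  refine ge_of_tendsto hlim ?_
  filter_upwards [self_mem_nhdsWithin] with δ hδ
  have hδ : 0 < δ := hδ
  have hX : 0 < √(x + δ) := Real.sqrt_pos.2 (by linarith)
  have hY : 0 < √(y + δ) := Real.sqrt_pos.2 (by linarith)
  refine (h (√(y + δ) / √(x + δ)) (by positivity)).trans (ENNReal.ofReal_le_ofReal ?_)
  calc _ ≤ √(y + δ) / √(x + δ) * (x + δ) + (√(y + δ) / √(x + δ))⁻¹ * (y + δ) := by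
        gcongr <;> linarith
    _ = √(y + δ) / √(x + δ) * √(x + δ) ^ 2 + (√(y + δ) / √(x + δ))⁻¹ * √(y + δ) ^ 2 := by
        rw [Real.sq_sqrt (by linarith), Real.sq_sqrt (by linarith)]
    _ = 2 * (√(x + δ) * √(y + δ)) := by field_simp; ring
    _ = _ := by rw [Real.sqrt_mul (by linarith)]

theorem lintegral_comp_smul_R3 (f : R3 → ℝ≥0∞) (hf : Measurable f) {c : ℝ} (hc : 0 < c) :
    ∫⁻ x, f (c • x) = ENNReal.ofReal (c ^ (-3 : ℝ)) * ∫⁻ x, f x := by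
  rw [← lintegral_map hf (measurable_const_smul c), Measure.map_addHaar_smul _ hc.ne',
    lintegral_smul_measure]
  simp only [finrank_euclideanSpace, Fintype.card_fin, smul_eq_mul]
  congr 2
  rw [abs_of_pos (by positivity), Real.rpow_neg hc.le]
  norm_cast

theorem lintegral_radial_ne_top {h : ℝ → ℝ}
    (hi : IntegrableOn (fun r => r ^ 2 * h r) (Set.Ioi 0)) :
    ∫⁻ x : R3, ENNReal.ofReal (h ‖x‖) ≠ ⊤ := by
  have : Integrable (fun x : R3 => h ‖x‖) := by
    rw [integrable_fun_norm_addHaar (volume : Measure R3) (f := h)]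
    simpa [finrank_euclideanSpace] using hi
  exact this.lintegral_lt_top.ne

/-- The power of R vanishes at the critical α = b/3 and has opposite signs on its two sides. This is
what makes an optimisation over R possible. -/
theorem lintegral_rpow_comp_smul (h : R3 → ℝ≥0∞) (hh : Measurable h) {R α b : ℝ} (hR : 0 < R)
    (hα : 0 < α) :
    (∫⁻ x, (ENNReal.ofReal (R ^ (-b)) * h (R⁻¹ • x)) ^ (1 / α)) ^ α =
      ENNReal.ofReal (R ^ (3 * α - b)) * (∫⁻ x, h x ^ (1 / α)) ^ α := by
  have hα' : 0 ≤ 1 / α := by positivity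
  simp_rw [ENNReal.mul_rpow_of_nonneg _ _ hα']
  have hm : Measurable fun x => h (R⁻¹ • x) ^ (1 / α) :=
    (hh.comp (measurable_const_smul _)).pow_const _
  rw [lintegral_const_mul _ hm,
    lintegral_comp_smul_R3 (fun x => h x ^ (1 / α)) (hh.pow_const _) (inv_pos.2 hR),
    ENNReal.mul_rpow_of_nonneg _ _ hα.le, ENNReal.mul_rpow_of_nonneg _ _ hα.le, ← mul_assoc,
    ← ENNReal.rpow_mul, one_div_mul_cancel hα.ne', ENNReal.rpow_one,
    ENNReal.ofReal_rpow_of_pos (by positivity), ← ENNReal.ofReal_mul (by positivity)]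
  congr 2
  rw [← Real.rpow_mul (by positivity), Real.inv_rpow hR.le, ← Real.rpow_neg hR.le,
    ← Real.rpow_add hR]
  ring_nf

theorem ofReal_one_div_rpow_rpow {r b α : ℝ} (hr : 0 ≤ r) (hα : 0 < α) :
    ENNReal.ofReal (1 / r ^ b) ^ (1 / α) = ENNReal.ofReal (r ^ (-(b / α))) := by
  rw [ENNReal.ofReal_rpow_of_nonneg (by positivity) (by positivity), one_div, ← Real.rpow_neg hr,
    ← Real.rpow_mul hr]
  congr 2
  ring

theorem measurable_ofReal_one_div_norm_rpow (b : ℝ) :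
    Measurable fun x : R3 => ENNReal.ofReal (1 / ‖x‖ ^ b) := by fun_prop

/-- In polar coordinates this is r^(2 - b/α) on (0, 1), integrable exactly when b/α < 3; the tail of
the kernel needs the reverse inequality. -/
theorem lintegral_indicator_ball_ne_top {b α : ℝ} (hα : 0 < α) (h : b < 3 * α) :
    ∫⁻ x : R3, (Metric.ball (0 : R3) 1).indicator
      (fun x => ENNReal.ofReal (1 / ‖x‖ ^ b)) x ^ (1 / α) ≠ ⊤ := by
  have hα' : 0 < 1 / α := by positivity
  have := lintegral_radial_ne_top (h := (Set.Iio 1).indicator fun r => r ^ (-(b / α))) ?_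
  · convert this using 3 with x
    by_cases hx : ‖x‖ < 1
    · simp [hx, -one_div, ofReal_one_div_rpow_rpow (norm_nonneg x) hα]
    · simp [hx, -one_div, hα']
  · have h1 : IntegrableOn (fun r : ℝ => r ^ (2 - b / α)) (Set.Ioo 0 1) := by
      rw [intervalIntegral.integrableOn_Ioo_rpow_iff one_pos]
      have : b / α < 3 := by rw [div_lt_iff₀ hα]; exact h
      linarith
    have h2 := (integrable_indicator_iff measurableSet_Ioo).2 h1
    refine h2.integrableOn.congr_fun (fun r hr => ?_) measurableSet_Ioi
    have hr : 0 < r := hr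
    by_cases h1 : r < 1
    · simp only [Set.indicator, Set.mem_Ioo, Set.mem_Iio, h1, hr, and_self, if_true]
      rw [sub_eq_add_neg, Real.rpow_add hr, Real.rpow_ofNat]
    · simp [Set.indicator, h1]

theorem lintegral_indicator_compl_ball_ne_top {b α : ℝ} (hα : 0 < α)
    (h : 3 * α < b) :
    ∫⁻ x : R3, (Metric.ball (0 : R3) 1)ᶜ.indicator
      (fun x => ENNReal.ofReal (1 / ‖x‖ ^ b)) x ^ (1 / α) ≠ ⊤ := by
  have hα' : 0 < 1 / α := by positivity
  have := lintegral_radial_ne_top (h := (Set.Ici 1).indicator fun r => r ^ (-(b / α))) ?_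
  · convert this using 3 with x
    by_cases hx : 1 ≤ ‖x‖
    · simp [hx, -one_div, ofReal_one_div_rpow_rpow (norm_nonneg x) hα]
    · simp [hx, -one_div, hα']
  · have h1 : IntegrableOn (fun r : ℝ => r ^ (2 - b / α)) (Set.Ici 1) := by
      rw [integrableOn_Ici_iff_integrableOn_Ioi]
      refine integrableOn_Ioi_rpow_of_lt ?_ one_pos
      have : 3 < b / α := by rw [lt_div_iff₀ hα]; exact h
      linarith
    have h2 := (integrable_indicator_iff measurableSet_Ici).2 h1
    refine h2.integrableOn.congr_fun (fun r hr => ?_) measurableSet_Ioi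
    have hr : 0 < r := hr
    by_cases h1 : 1 ≤ r
    · simp only [Set.indicator, Set.mem_Ici, h1, if_true]
      rw [sub_eq_add_neg, Real.rpow_add hr, Real.rpow_ofNat]
    · simp [Set.indicator, h1]

/-- The bilinear Riesz form is controlled by the geometric mean of two Lebesgue norms on either
side of the conformal exponent. -/
theorem exists_riesz_bilinear_le {b ε : ℝ} (hb0 : 0 < b) (hε : 0 < ε) (hε1 : b / 3 + 2 * ε ≤ 1)
    (hε2 : 2 * ε < b / 3) :
    ∃ C : ℝ, 0 ≤ C ∧ ∀ f g : R3 → ℝ≥0∞, Measurable f → Measurable g → ∀ a₁ a₂ : ℝ,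
      0 ≤ a₁ → 0 ≤ a₂ →
      (∫⁻ x, f x ^ (1 / (1 - b / 6 - ε))) ^ (1 - b / 6 - ε) *
        (∫⁻ x, g x ^ (1 / (1 - b / 6 - ε))) ^ (1 - b / 6 - ε) ≤ ENNReal.ofReal a₁ →
      (∫⁻ x, f x ^ (1 / (1 - b / 6 + ε))) ^ (1 - b / 6 + ε) *
        (∫⁻ x, g x ^ (1 / (1 - b / 6 + ε))) ^ (1 - b / 6 + ε) ≤ ENNReal.ofReal a₂ →
      ∫⁻ x, (∫⁻ y, ENNReal.ofReal (1 / ‖x - y‖ ^ b) * f y) * g x ≤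
        ENNReal.ofReal (C * √(a₁ * a₂)) := by
  set k : R3 → ℝ≥0∞ := fun x => ENNReal.ofReal (1 / ‖x‖ ^ b) with hk
  set k₁ := (Metric.ball (0 : R3) 1).indicator k with hk₁
  set k₂ := (Metric.ball (0 : R3) 1)ᶜ.indicator k with hk₂
  have hkm : Measurable k := measurable_ofReal_one_div_norm_rpow b
  have hk₁m : Measurable k₁ := hkm.indicator Metric.isOpen_ball.measurableSet
  have hk₂m : Measurable k₂ := hkm.indicator Metric.isOpen_ball.measurableSet.compl
  set α₁ := b / 3 + 2 * ε with hα₁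
  set α₂ := b / 3 - 2 * ε with hα₂
  have p1 : 0 < α₁ := by positivity
  have p2 : 0 < α₂ := by linarith
  set κ₁ := (∫⁻ x, k₁ x ^ (1 / α₁)) ^ α₁
  set κ₂ := (∫⁻ x, k₂ x ^ (1 / α₂)) ^ α₂
  have hκ₁ : κ₁ ≠ ⊤ := ENNReal.rpow_ne_top_of_nonneg p1.le
    (lintegral_indicator_ball_ne_top p1 (by linarith))
  have hκ₂ : κ₂ ≠ ⊤ := ENNReal.rpow_ne_top_of_nonneg p2.le
    (lintegral_indicator_compl_ball_ne_top p2 (by linarith))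
  refine ⟨2 * √(κ₁.toReal * κ₂.toReal), by positivity, fun f g hf hg a₁ a₂ ha₁ ha₂ h₁ h₂ => ?_⟩
  have main := le_two_mul_sqrt_of_forall_le
    (z := ∫⁻ x, (∫⁻ y, ENNReal.ofReal (1 / ‖x - y‖ ^ b) * f y) * g x)
    (x := κ₁.toReal * a₁) (y := κ₂.toReal * a₂) (by positivity) (by positivity) ?_
  · refine main.trans_eq ?_
    rw [mul_assoc 2, ← Real.sqrt_mul (by positivity)]
    congr 3
    ring
  intro t ht
  -- The near part scales like R^(6ε) and the far part like R^(-6ε), so this radius gives them the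
  -- factors t and t⁻¹.
  set R := t ^ (1 / (6 * ε)) with hR
  have hRpos : 0 < R := by positivity
  let s₁ : R3 → ℝ≥0∞ := fun x => ENNReal.ofReal (R ^ (-b)) * k₁ (R⁻¹ • x)
  let s₂ : R3 → ℝ≥0∞ := fun x => ENNReal.ofReal (R ^ (-b)) * k₂ (R⁻¹ • x)
  have hs₁m : Measurable s₁ := (hk₁m.comp (measurable_const_smul _)).const_mul _
  have hs₂m : Measurable s₂ := (hk₂m.comp (measurable_const_smul _)).const_mul _
  have hsplit : ∀ x : R3, ENNReal.ofReal (1 / ‖x‖ ^ b) = s₁ x + s₂ x := by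
    intro x
    have : k₁ (R⁻¹ • x) + k₂ (R⁻¹ • x) = k (R⁻¹ • x) := by
      rw [hk₁, hk₂]; exact congrFun (Set.indicator_self_add_compl (Metric.ball (0 : R3) 1) k) _
    simp only [s₁, s₂]
    rw [← mul_add, this, hk, ← ENNReal.ofReal_mul (by positivity), norm_smul, norm_inv,
      Real.norm_of_nonneg hRpos.le, Real.mul_rpow (by positivity) (norm_nonneg x),
      Real.inv_rpow hRpos.le, Real.rpow_neg hRpos.le]
    congr 1
    have : R ^ b ≠ 0 := by positivity
    field_simp
  have hRt : R ^ (6 * ε) = t := by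
    rw [hR, ← Real.rpow_mul ht.le, one_div_mul_cancel (by positivity), Real.rpow_one]
  have n₁ : (∫⁻ x, s₁ x ^ (1 / α₁)) ^ α₁ = ENNReal.ofReal t * κ₁ := by
    rw [lintegral_rpow_comp_smul k₁ hk₁m hRpos p1, show 3 * α₁ - b = 6 * ε by rw [hα₁]; ring, hRt]
  have n₂ : (∫⁻ x, s₂ x ^ (1 / α₂)) ^ α₂ = ENNReal.ofReal t⁻¹ * κ₂ := by
    rw [lintegral_rpow_comp_smul k₂ hk₂m hRpos p2, show 3 * α₂ - b = -(6 * ε) by rw [hα₂]; ring,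
      Real.rpow_neg hRpos.le, hRt]
  have y₁ := lintegral_conv_mul_le volume hf hg hs₁m (σ := 1 - b / 6 - ε) p1 hε1
    (by rw [hα₁]; ring)
  have y₂ := lintegral_conv_mul_le volume hf hg hs₂m (σ := 1 - b / 6 + ε) p2 (by linarith)
    (by rw [hα₂]; ring)
  rw [n₁] at y₁
  rw [n₂] at y₂
  have m₁ : ∀ x, Measurable fun y => s₁ (x - y) * f y := fun x =>
    (hs₁m.comp (measurable_id.const_sub x)).mul hf
  have hm : Measurable fun x => (∫⁻ y, s₁ (x - y) * f y) * g x := by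
    refine Measurable.mul ?_ hg
    exact Measurable.lintegral_prod_right
      ((hs₁m.comp (measurable_fst.sub measurable_snd)).mul (hf.comp measurable_snd))
  calc ∫⁻ x, (∫⁻ y, ENNReal.ofReal (1 / ‖x - y‖ ^ b) * f y) * g x
      = ∫⁻ x, ((∫⁻ y, s₁ (x - y) * f y) * g x + (∫⁻ y, s₂ (x - y) * f y) * g x) := by
        refine lintegral_congr fun x => ?_
        rw [← add_mul, ← lintegral_add_left (m₁ x)]
        simp_rw [hsplit, add_mul]
    _ = _ := lintegral_add_left hm _
    _ ≤ ENNReal.ofReal t * κ₁ * ENNReal.ofReal a₁ + ENNReal.ofReal t⁻¹ * κ₂ * ENNReal.ofReal a₂ :=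
        add_le_add (y₁.trans (by gcongr)) (y₂.trans (by gcongr))
    _ = ENNReal.ofReal (t * (κ₁.toReal * a₁) + t⁻¹ * (κ₂.toReal * a₂)) := by
        rw [ENNReal.ofReal_add (by positivity) (by positivity), ENNReal.ofReal_mul ht.le,
          ENNReal.ofReal_mul (by positivity), ENNReal.ofReal_mul (by positivity),
          ENNReal.ofReal_mul (by positivity), ENNReal.ofReal_toReal hκ₁,
          ENNReal.ofReal_toReal hκ₂, mul_assoc, mul_assoc]

/-! ### Mollification in L² -/

/-- Jensen's inequality for the probability density w, obtained from Cauchy–Schwarz by writing w h =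
w^(1/2) (w h²)^(1/2); then Tonelli. -/
theorem lintegral_conv_sq_le {G : Type*} [AddCommGroup G] [MeasurableSpace G]
    [MeasurableAdd₂ G] [MeasurableNeg G] (μ : Measure G) [SFinite μ] [μ.IsAddLeftInvariant]
    [μ.IsNegInvariant] {w h : G → ℝ≥0∞} (hw : Measurable w) (hh : Measurable h)
    (hw1 : ∫⁻ x, w x ∂μ = 1) :
    ∫⁻ x, (∫⁻ y, w (x - y) * h y ∂μ) ^ (2 : ℝ) ∂μ ≤ ∫⁻ x, h x ^ (2 : ℝ) ∂μ := by
  have hsub : Measurable fun z : G × G => z.1 - z.2 := by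
    simp only [sub_eq_add_neg]; exact measurable_fst.add measurable_snd.neg
  have hwr : ∀ x, Measurable fun y => w (x - y) := fun x =>
    hw.comp (measurable_id.const_sub x)
  have hwl : ∀ y, Measurable fun x => w (x - y) := fun y =>
    hw.comp (measurable_id.sub_const y)
  have hh2 := hh.pow_const (2 : ℝ)
  have cs : ∀ x, (∫⁻ y, w (x - y) * h y ∂μ) ^ (2 : ℝ) ≤ ∫⁻ y, w (x - y) * h y ^ (2 : ℝ) ∂μ := by
    intro x
    have key := ENNReal.lintegral_mul_norm_pow_le (μ := μ) (f := fun y => w (x - y))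
      (g := fun y => w (x - y) * h y ^ (2 : ℝ)) (hwr x).aemeasurable
      ((hwr x).mul hh2).aemeasurable (p := 1 / 2) (q := 1 / 2) (by norm_num) (by norm_num)
      (by norm_num)
    have e : ∀ y, w (x - y) ^ (1 / 2 : ℝ) * (w (x - y) * h y ^ (2 : ℝ)) ^ (1 / 2 : ℝ) =
        w (x - y) * h y := by
      intro y
      rw [ENNReal.mul_rpow_of_nonneg _ _ (by norm_num), ← mul_assoc,
        ← ENNReal.rpow_add_of_nonneg _ _ (by norm_num) (by norm_num), ← ENNReal.rpow_mul]
      norm_num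
    have e' : ∫⁻ y, w (x - y) ∂μ = 1 := by
      rw [lintegral_sub_left_eq_self w x, hw1]
    simp only [e, e', ENNReal.one_rpow, one_mul] at key
    calc _ ≤ ((∫⁻ y, w (x - y) * h y ^ (2 : ℝ) ∂μ) ^ (1 / 2 : ℝ)) ^ (2 : ℝ) := by gcongr
      _ = _ := by rw [← ENNReal.rpow_mul]; norm_num
  calc _ ≤ ∫⁻ x, ∫⁻ y, w (x - y) * h y ^ (2 : ℝ) ∂μ ∂μ := lintegral_mono cs
    _ = ∫⁻ y, ∫⁻ x, w (x - y) * h y ^ (2 : ℝ) ∂μ ∂μ := by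
        refine lintegral_lintegral_swap (Measurable.aemeasurable ?_)
        exact (hw.comp hsub).mul (hh2.comp measurable_snd)
    _ = _ := by
        refine lintegral_congr fun y => ?_
        rw [lintegral_mul_const _ (hwl y), lintegral_sub_right_eq_self w y, hw1, one_mul]

theorem eLpNorm_two_eq {F : Type*} [NormedAddCommGroup F] (f : R3 → F) :
    eLpNorm f 2 volume = (∫⁻ x, ‖f x‖ₑ ^ (2 : ℝ)) ^ (1 / 2 : ℝ) := by
  rw [eLpNorm_eq_lintegral_rpow_enorm_toReal two_ne_zero ENNReal.ofNat_ne_top]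
  simp

/-- A function dominated by a multiple of a mollification is controlled in `L²`. -/
theorem eLpNorm_two_le_of_enorm_le_conv {F F' : Type*} [NormedAddCommGroup F]
    [NormedAddCommGroup F'] {ρ : R3 → ℝ} (hρ : Measurable ρ) (hρ0 : ∀ x, 0 ≤ ρ x)
    (hρi : Integrable ρ) (hρ1 : ∫ x, ρ x = 1) {f : R3 → F} {h : R3 → F'} (hh : StronglyMeasurable h)
    (c : ℝ≥0∞)
    (hfh : ∀ x, ‖f x‖ₑ ≤ c * ∫⁻ y, ENNReal.ofReal (ρ (x - y)) * ‖h y‖ₑ) :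
    eLpNorm f 2 volume ≤ c * eLpNorm h 2 volume := by
  have h1 : ∫⁻ x, ENNReal.ofReal (ρ x) = 1 := by
    rw [← ofReal_integral_eq_lintegral_ofReal hρi (Eventually.of_forall hρ0), hρ1]; simp
  have hm : Measurable fun x => ∫⁻ y, ENNReal.ofReal (ρ (x - y)) * ‖h y‖ₑ :=
    Measurable.lintegral_prod_right
      (((hρ.comp (measurable_fst.sub measurable_snd)).ennreal_ofReal).mul
        (hh.enorm.comp measurable_snd))
  have key := lintegral_conv_sq_le volume hρ.ennreal_ofReal hh.enorm h1
  rw [eLpNorm_two_eq, eLpNorm_two_eq]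
  calc _ ≤ (∫⁻ x, (c * ∫⁻ y, ENNReal.ofReal (ρ (x - y)) * ‖h y‖ₑ) ^ (2 : ℝ)) ^ (1 / 2 : ℝ) := by
        gcongr with x; exact hfh x
    _ = c * (∫⁻ x, (∫⁻ y, ENNReal.ofReal (ρ (x - y)) * ‖h y‖ₑ) ^ (2 : ℝ)) ^ (1 / 2 : ℝ) := by
        simp_rw [ENNReal.mul_rpow_of_nonneg _ _ (zero_le_two : (0 : ℝ) ≤ 2)]
        rw [lintegral_const_mul _ (hm.pow_const _), ENNReal.mul_rpow_of_nonneg _ _ (by norm_num),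
          ← ENNReal.rpow_mul]
        norm_num
    _ ≤ _ := by gcongr

/-- Weak gradients are given by components, while the Sobolev inequality for smooth functions uses
the operator norm of the derivative. This crude comparison suffices because constants are free. -/
theorem enorm_clm_le_sum (L : R3 →L[ℝ] ℂ) :
    ‖L‖ₑ ≤ ∑ i : Fin 3, ‖L (EuclideanSpace.single i 1)‖ₑ := by
  have : ‖L‖ ≤ ∑ i : Fin 3, ‖L (EuclideanSpace.single i 1)‖ := by
    refine L.opNorm_le_bound (by positivity) fun x => ?_
    have hx : x = ∑ i : Fin 3, x i • EuclideanSpace.single i (1 : ℝ) := by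
      ext j; simp [Finset.sum_apply, Pi.single_apply]
    calc ‖L x‖ = ‖∑ i : Fin 3, x i • L (EuclideanSpace.single i (1 : ℝ))‖ := by
          conv_lhs => rw [hx, map_sum]
          simp only [map_smul]
      _ ≤ ∑ i : Fin 3, ‖x i • L (EuclideanSpace.single i (1 : ℝ))‖ := norm_sum_le _ _
      _ ≤ ∑ i : Fin 3, ‖x‖ * ‖L (EuclideanSpace.single i (1 : ℝ))‖ := by
          gcongr with i
          rw [norm_smul]
          gcongr
          exact PiLp.norm_apply_le x i
      _ = _ := by rw [← Finset.mul_sum, mul_comm]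
  simp only [← ofReal_norm]
  rw [← ENNReal.ofReal_sum_of_nonneg (fun _ _ => norm_nonneg _)]
  exact ENNReal.ofReal_le_ofReal this

-- The derivative falls on ρ, and y ↦ ρ(x - y) serves as test function. The sign from
-- differentiating the reflection cancels the one in the definition of the weak gradient.
open scoped Convolution in
theorem HasWeakGradient.fderiv_convolution {φ : R3 → ℂ} {g : R3 → EuclideanSpace ℂ (Fin 3)}
    (h : HasWeakGradient φ g) {ρ : R3 → ℝ} (hρ : ContDiff ℝ ∞ ρ) (hc : HasCompactSupport ρ)
    (x : R3) (i : Fin 3) :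
    fderiv ℝ (ρ ⋆[ContinuousLinearMap.lsmul ℝ ℝ] φ) x (EuclideanSpace.single i 1) =
      ∫ y, ρ (x - y) • g y i := by
  set L : ℝ →L[ℝ] ℂ →L[ℝ] ℂ := ContinuousLinearMap.lsmul ℝ ℝ
  have hρ1 : ContDiff ℝ 1 ρ := hρ.of_le (by simp)
  rw [(hc.hasFDerivAt_convolution_left L hρ1 h.locallyIntegrable x).fderiv, convolution_def,
    ContinuousLinearMap.integral_apply]
  -- The argument t is written as x - (x - t) to make the integrand a function of x - t, ready for
  -- the change of variables.
  · have step : ∀ t, (L.precompL R3 (fderiv ℝ ρ t) (φ (x - t))) (EuclideanSpace.single i 1) =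
        (fderiv ℝ ρ (x - (x - t)) (EuclideanSpace.single i 1)) • φ (x - t) := by
      intro t
      simp [L, ContinuousLinearMap.precompL_apply]
    simp_rw [step]
    rw [integral_sub_left_eq_self
      (fun y => (fderiv ℝ ρ (x - y) (EuclideanSpace.single i 1)) • φ y) volume x]
    have key := h.integral_eq (fun y => ρ (x - y)) (hρ.comp (contDiff_const.sub contDiff_id))
      (hc.comp_homeomorph (Homeomorph.subLeft x)) i
    have hd : ∀ y, fderiv ℝ (fun y => ρ (x - y)) y = -fderiv ℝ ρ (x - y) := by
      intro y
      have h1 : HasFDerivAt (fun y : R3 => x - y) (-ContinuousLinearMap.id ℝ R3) y := by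
        simpa using (hasFDerivAt_id y).const_sub x
      have h2 : HasFDerivAt (fun y : R3 => ρ (x - y))
          (fderiv ℝ ρ (x - y) ∘SL (-ContinuousLinearMap.id ℝ R3)) y :=
        ((hρ1.differentiable one_ne_zero).differentiableAt (x := x - y)).hasFDerivAt.comp y h1
      rw [h2.fderiv]
      ext v
      simp
    simp only [hd, neg_apply, neg_smul, integral_neg] at key
    exact neg_injective key
  · exact (hc.fderiv ℝ).convolutionExists_left (L.precompL R3) (hρ1.continuous_fderiv one_ne_zero)
      h.locallyIntegrable x

theorem enorm_integral_smul_le {F : Type*} [NormedAddCommGroup F] [NormedSpace ℝ F]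
    {ρ : R3 → ℝ} (hρ0 : ∀ x, 0 ≤ ρ x) (f : R3 → F) (x : R3) :
    ‖∫ y, ρ (x - y) • f y‖ₑ ≤ ∫⁻ y, ENNReal.ofReal (ρ (x - y)) * ‖f y‖ₑ := by
  refine (enorm_integral_le_lintegral_enorm _).trans_eq (lintegral_congr fun y => ?_)
  rw [enorm_smul, Real.enorm_of_nonneg (hρ0 _)]

open scoped Convolution in
theorem HasWeakGradient.eLpNorm_fderiv_convolution_le {φ : R3 → ℂ}
    {g : R3 → EuclideanSpace ℂ (Fin 3)} (h : HasWeakGradient φ g) (hg : StronglyMeasurable g)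
    {ρ : R3 → ℝ} (hρ : ContDiff ℝ ∞ ρ) (hc : HasCompactSupport ρ) (hρ0 : ∀ x, 0 ≤ ρ x)
    (hρ1 : ∫ x, ρ x = 1) :
    eLpNorm (fderiv ℝ (ρ ⋆[ContinuousLinearMap.lsmul ℝ ℝ] φ)) 2 volume ≤
      3 * eLpNorm g 2 volume := by
  refine eLpNorm_two_le_of_enorm_le_conv hρ.continuous.measurable hρ0
    (hρ.continuous.integrable_of_hasCompactSupport hc) hρ1 hg 3 fun x => ?_
  refine (enorm_clm_le_sum _).trans ?_
  calc _ ≤ ∑ i : Fin 3, ∫⁻ y, ENNReal.ofReal (ρ (x - y)) * ‖g y‖ₑ := by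
        refine Finset.sum_le_sum fun i _ => ?_
        rw [h.fderiv_convolution hρ hc]
        refine (enorm_integral_smul_le hρ0 _ x).trans ?_
        gcongr with y
        exact enorm_le_iff_norm_le.2 (PiLp.norm_apply_le (g y) i)
    _ = _ := by simp

open scoped Convolution in
theorem eLpNorm_convolution_le {φ : R3 → ℂ} (hφ : StronglyMeasurable φ)
    {ρ : R3 → ℝ} (hρ : Continuous ρ) (hc : HasCompactSupport ρ) (hρ0 : ∀ x, 0 ≤ ρ x)
    (hρ1 : ∫ x, ρ x = 1) :
    eLpNorm (ρ ⋆[ContinuousLinearMap.lsmul ℝ ℝ] φ) 2 volume ≤ eLpNorm φ 2 volume := by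
  rw [← one_mul (eLpNorm φ 2 volume)]
  refine eLpNorm_two_le_of_enorm_le_conv hρ.measurable hρ0
    (hρ.integrable_of_hasCompactSupport hc) hρ1 hφ 1 fun x => ?_
  rw [one_mul, convolution_lsmul_swap]
  exact enorm_integral_smul_le hρ0 _ x

/-! ### The Sobolev inequality -/

/-- The Sobolev inequality for `C¹` functions in `L²`, without compact support. -/
theorem exists_sobolev_contDiff : ∃ C : ℝ≥0∞, C ≠ ⊤ ∧ ∀ ψ : R3 → ℂ, ContDiff ℝ 1 ψ →
    eLpNorm ψ 2 volume ≠ ⊤ → eLpNorm ψ 6 volume ≤ C * eLpNorm (fderiv ℝ ψ) 2 volume := by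
  refine ⟨SNormLESNormFDerivOfEqConst ℂ (volume : Measure R3) 2, ENNReal.coe_ne_top,
    fun ψ hψ hψ2 => ?_⟩
  set C : ℝ≥0∞ := ENNReal.ofNNReal (SNormLESNormFDerivOfEqConst ℂ (volume : Measure R3) 2)
  -- The dilated cutoff χ(c_n x) tends to 1 pointwise and adds at most c_n M ‖ψ‖₂ to the gradient
  -- norm. That error vanishes because ψ is in L², and Fatou passes the compactly supported
  -- inequality to the limit.
  let χ : ContDiffBump (0 : R3) := ⟨1, 2, one_pos, one_lt_two⟩
  have hχ : ContDiff ℝ 1 χ := χ.contDiff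
  obtain ⟨M, hM⟩ := (χ.hasCompactSupport.fderiv ℝ).exists_bound_of_continuous
    (hχ.continuous_fderiv one_ne_zero)
  let c : ℕ → ℝ := fun n => 1 / ((n : ℝ) + 1)
  have hc : ∀ n, 0 < c n := fun n => by positivity
  have hclim : Tendsto c atTop (𝓝 0) := tendsto_one_div_add_atTop_nhds_zero_nat
  let f : ℕ → R3 → ℂ := fun n x => χ (c n • x) • ψ x
  have hχn : ∀ n, ContDiff ℝ 1 fun x : R3 => χ (c n • x) := fun n =>
    hχ.comp (contDiff_const_smul _)
  have hf : ∀ n, ContDiff ℝ 1 (f n) := fun n => (hχn n).smul hψ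
  have hlim : ∀ x, Tendsto (fun n => f n x) atTop (𝓝 (ψ x)) := by
    intro x
    have h1 : Tendsto (fun n => c n • x) atTop (𝓝 ((0 : ℝ) • x)) := hclim.smul_const x
    rw [zero_smul] at h1
    have h2 := (χ.continuous.tendsto (0 : R3)).comp h1
    have h3 : χ (0 : R3) = 1 := χ.one_of_mem_closedBall (by simp [χ.rIn_pos.le])
    rw [h3] at h2
    have h4 := h2.smul_const (ψ x)
    rwa [one_smul] at h4
  have hcs : ∀ n, HasCompactSupport (f n) := by
    intro n
    have : HasCompactSupport fun x : R3 => χ (c n • x) :=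
      χ.hasCompactSupport.comp_smul (hc n).ne'
    exact this.smul_right
  have hfd : ∀ n x, ‖fderiv ℝ (f n) x‖ₑ ≤
      ‖fderiv ℝ ψ x‖ₑ + ENNReal.ofReal (c n * M) * ‖ψ x‖ₑ := by
    intro n x
    have d1 := ((hχn n).differentiable one_ne_zero).differentiableAt (x := x)
    have d2 := (hψ.differentiable one_ne_zero).differentiableAt (x := x)
    have e1 : fderiv ℝ (fun x : R3 => χ (c n • x)) x = c n • fderiv ℝ χ (c n • x) :=
      fderiv_comp_smul _
    have e : fderiv ℝ (f n) x = χ (c n • x) • fderiv ℝ ψ x +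
        (c n • fderiv ℝ χ (c n • x)).smulRight (ψ x) := by
      rw [← e1]; exact fderiv_fun_smul d1 d2
    have hM0 : 0 ≤ M := (norm_nonneg _).trans (hM 0)
    rw [e, ← ofReal_norm, ← ofReal_norm, ← ofReal_norm,
      ← ENNReal.ofReal_mul (mul_nonneg (hc n).le hM0),
      ← ENNReal.ofReal_add (norm_nonneg _)
        (mul_nonneg (mul_nonneg (hc n).le hM0) (norm_nonneg _))]
    refine ENNReal.ofReal_le_ofReal ((norm_add_le _ _).trans ?_)
    rw [norm_smul, ContinuousLinearMap.norm_smulRight_apply, norm_smul,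
      Real.norm_of_nonneg (hc n).le, Real.norm_of_nonneg χ.nonneg]
    gcongr
    · exact mul_le_of_le_one_left (norm_nonneg _) χ.le_one
    · exact hM _
  have hfd2 : ∀ n, eLpNorm (fderiv ℝ (f n)) 2 volume ≤
      eLpNorm (fderiv ℝ ψ) 2 volume + ENNReal.ofReal (c n * M) * eLpNorm ψ 2 volume := by
    intro n
    have hM0 : 0 ≤ M := (norm_nonneg _).trans (hM 0)
    have m1 : AEStronglyMeasurable (fun x => ‖fderiv ℝ ψ x‖) volume :=
      (hψ.continuous_fderiv one_ne_zero).norm.aestronglyMeasurable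
    have m2 : AEStronglyMeasurable (fun x => (c n * M) • ‖ψ x‖) volume :=
      (hψ.continuous.norm.const_smul (c n * M)).aestronglyMeasurable
    calc _ ≤ eLpNorm ((fun x => ‖fderiv ℝ ψ x‖) + fun x => (c n * M) • ‖ψ x‖) 2 volume := by
          refine eLpNorm_mono_enorm fun x => (hfd n x).trans_eq ?_
          have : 0 ≤ c n * M := mul_nonneg (hc n).le hM0
          simp only [Pi.add_apply, smul_eq_mul]
          rw [Real.enorm_of_nonneg (by positivity), ENNReal.ofReal_add (by positivity)
            (by positivity), ENNReal.ofReal_mul this, ofReal_norm, ofReal_norm]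
      _ ≤ _ := eLpNorm_add_le m1 m2 one_le_two
      _ = _ := by
          have : (fun x => (c n * M) • ‖ψ x‖) = (c n * M) • fun x => ‖ψ x‖ := rfl
          rw [this, eLpNorm_const_smul, eLpNorm_norm, eLpNorm_norm,
            Real.enorm_of_nonneg (mul_nonneg (hc n).le hM0)]
  have hbound : ∀ n, eLpNorm (f n) 6 volume ≤
      C * (eLpNorm (fderiv ℝ ψ) 2 volume + ENNReal.ofReal (c n * M) * eLpNorm ψ 2 volume) := by
    intro n
    have := eLpNorm_le_eLpNorm_fderiv_of_eq (volume : Measure R3) (hf n) (hcs n) (p := 2) (p' := 6)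
      one_le_two (by simp [finrank_euclideanSpace]) (by simp [finrank_euclideanSpace]; norm_num)
    refine le_trans (by exact_mod_cast this) ?_
    gcongr
    exact_mod_cast hfd2 n
  have htend : Tendsto (fun n => C * (eLpNorm (fderiv ℝ ψ) 2 volume +
      ENNReal.ofReal (c n * M) * eLpNorm ψ 2 volume)) atTop
      (𝓝 (C * (eLpNorm (fderiv ℝ ψ) 2 volume + ENNReal.ofReal (0 * M) * eLpNorm ψ 2 volume))) := by
    refine ENNReal.Tendsto.const_mul ?_ (Or.inr ENNReal.coe_ne_top)
    refine tendsto_const_nhds.add (ENNReal.Tendsto.mul_const ?_ (Or.inr hψ2))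
    exact ENNReal.tendsto_ofReal (hclim.mul_const M)
  have fatou := Lp.eLpNorm_lim_le_liminf_eLpNorm (p := 6) (μ := volume)
    (fun n => (hf n).continuous.aestronglyMeasurable) ψ (Eventually.of_forall hlim)
  calc _ ≤ _ := fatou
    _ ≤ _ := liminf_le_liminf (Eventually.of_forall hbound)
    _ = _ := htend.liminf_eq
    _ = _ := by simp

theorem HasWeakGradient.congr_ae {φ φ' : R3 → ℂ} {g g' : R3 → EuclideanSpace ℂ (Fin 3)}
    (h : HasWeakGradient φ g) (hφ : φ =ᵐ[volume] φ') (hg : g =ᵐ[volume] g') :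
    HasWeakGradient φ' g' where
  locallyIntegrable := h.locallyIntegrable.congr hφ
  locallyIntegrable_grad := h.locallyIntegrable_grad.congr hg
  integral_eq η hη hc i := by
    have h1 : ∫ x, (fderiv ℝ η x (EuclideanSpace.single i 1)) • φ' x =
        ∫ x, (fderiv ℝ η x (EuclideanSpace.single i 1)) • φ x :=
      integral_congr_ae (by filter_upwards [hφ] with x hx; rw [hx])
    have h2 : ∫ x, η x • g' x i = ∫ x, η x • g x i :=
      integral_congr_ae (by filter_upwards [hg] with x hx; rw [hx])
    rw [h1, h2, h.integral_eq η hη hc i]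

open scoped Convolution in
/-- The Sobolev inequality in `H¹(ℝ³)`. -/
theorem exists_sobolev : ∃ C : ℝ≥0∞, C ≠ ⊤ ∧ ∀ (φ : R3 → ℂ) (g : R3 → EuclideanSpace ℂ (Fin 3)),
    MemLp φ 2 volume → HasWeakGradient φ g → AEStronglyMeasurable g volume →
    eLpNorm φ 6 volume ≤ C * eLpNorm g 2 volume := by
  obtain ⟨C, hC, hS⟩ := exists_sobolev_contDiff
  refine ⟨C * 3, ENNReal.mul_ne_top hC (by simp), fun φ₀ g₀ hφ₀ hw₀ hg₀ => ?_⟩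
  -- The convolution bounds use Tonelli, hence strongly measurable representatives.
  set φ := hφ₀.1.mk φ₀
  set g := hg₀.mk g₀
  have hφe : φ₀ =ᵐ[volume] φ := hφ₀.1.ae_eq_mk
  have hge : g₀ =ᵐ[volume] g := hg₀.ae_eq_mk
  have hw : HasWeakGradient φ g := hw₀.congr_ae hφe hge
  have hφm : StronglyMeasurable φ := hφ₀.1.stronglyMeasurable_mk
  have hgm : StronglyMeasurable g := hg₀.stronglyMeasurable_mk
  rw [eLpNorm_congr_ae hφe, eLpNorm_congr_ae hge]
  have hφ2 : eLpNorm φ 2 volume ≠ ⊤ := by rw [← eLpNorm_congr_ae hφe]; exact hφ₀.2.ne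
  -- Keeping the ratio of outer to inner radius fixed at 2 gives almost everywhere convergence of
  -- the mollifications by Lebesgue differentiation.
  let B : ℕ → ContDiffBump (0 : R3) := fun n =>
    ⟨1 / ((n : ℝ) + 1), 2 * (1 / ((n : ℝ) + 1)), by positivity, by
      have : 0 < 1 / ((n : ℝ) + 1) := by positivity
      linarith⟩
  let ψ : ℕ → R3 → ℂ := fun n =>
    ((B n).normed volume ⋆[ContinuousLinearMap.lsmul ℝ ℝ, volume] φ)
  have hlim : ∀ᵐ x, Tendsto (fun n => ψ n x) atTop (𝓝 (φ x)) := by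
    refine ContDiffBump.ae_convolution_tendsto_right_of_locallyIntegrable (K := 2) ?_
      (Eventually.of_forall fun n => le_rfl) hw.locallyIntegrable
    have h0 := (tendsto_one_div_add_atTop_nhds_zero_nat (𝕜 := ℝ)).const_mul 2
    rwa [mul_zero] at h0
  have hsm : ∀ n, ContDiff ℝ 1 (ψ n) := fun n =>
    (B n).hasCompactSupport_normed.contDiff_convolution_left _ (B n).contDiff_normed
      hw.locallyIntegrable
  have hb : ∀ n, eLpNorm (ψ n) 6 volume ≤ C * 3 * eLpNorm g 2 volume := by
    intro n
    have h2 : eLpNorm (ψ n) 2 volume ≤ eLpNorm φ 2 volume :=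
      eLpNorm_convolution_le hφm (B n).continuous_normed (B n).hasCompactSupport_normed
        (B n).nonneg_normed (B n).integral_normed
    refine (hS _ (hsm n) (ne_top_of_le_ne_top hφ2 h2)).trans ?_
    rw [mul_assoc]
    gcongr
    exact hw.eLpNorm_fderiv_convolution_le hgm (B n).contDiff_normed (B n).hasCompactSupport_normed
        (B n).nonneg_normed (B n).integral_normed
  have fatou := Lp.eLpNorm_lim_le_liminf_eLpNorm (p := 6) (μ := volume)
    (fun n => (hsm n).continuous.aestronglyMeasurable) φ hlim
  calc _ ≤ _ := fatou
    _ ≤ liminf (fun _ : ℕ => C * 3 * eLpNorm g 2 volume) atTop :=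
        liminf_le_liminf (Eventually.of_forall hb)
    _ = _ := by simp

/-! ### Interpolation between L² and L⁶ -/

/-- Hölder with weights (6 - r)/4 and (r - 2)/4, the convex combination of 2 and 6 that equals r. -/
theorem lintegral_rpow_le_of_eLpNorm_six_le {φ : R3 → ℂ} (hφ : AEStronglyMeasurable φ volume)
    {S L r : ℝ} (hS : 0 ≤ S) (hL : 0 ≤ L) (hr2 : 2 < r) (hr6 : r < 6)
    (h2 : eLpNorm φ 2 volume ≤ ENNReal.ofReal L) (h6 : eLpNorm φ 6 volume ≤ ENNReal.ofReal S) :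
    ∫⁻ x, ‖φ x‖ₑ ^ r ≤ ENNReal.ofReal (L ^ ((6 - r) / 2) * S ^ (3 * (r - 2) / 2)) := by
  have n2 : ∫⁻ x, ‖φ x‖ₑ ^ (2 : ℝ) = eLpNorm φ 2 volume ^ (2 : ℝ) := by
    rw [eLpNorm_two_eq, ← ENNReal.rpow_mul]; norm_num
  have n6 : ∫⁻ x, ‖φ x‖ₑ ^ (6 : ℝ) = eLpNorm φ 6 volume ^ (6 : ℝ) := by
    rw [eLpNorm_eq_lintegral_rpow_enorm_toReal (by norm_num) (by norm_num), ← ENNReal.rpow_mul]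
    norm_num
  have key := ENNReal.lintegral_mul_norm_pow_le (μ := volume) (f := fun x => ‖φ x‖ₑ ^ (2 : ℝ))
    (g := fun x => ‖φ x‖ₑ ^ (6 : ℝ)) (hφ.enorm.pow_const _) (hφ.enorm.pow_const _)
    (p := (6 - r) / 4) (q := (r - 2) / 4) (by linarith) (by linarith) (by ring)
  have e : ∀ x, (‖φ x‖ₑ ^ (2 : ℝ)) ^ ((6 - r) / 4) * (‖φ x‖ₑ ^ (6 : ℝ)) ^ ((r - 2) / 4) =
      ‖φ x‖ₑ ^ r := by
    intro x
    rw [← ENNReal.rpow_mul, ← ENNReal.rpow_mul,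
      ← ENNReal.rpow_add_of_nonneg _ _ (by linarith) (by linarith)]
    congr 1; ring
  simp only [e, n2, n6] at key
  simp only [← ENNReal.rpow_mul] at key
  refine key.trans ?_
  rw [show 2 * ((6 - r) / 4) = (6 - r) / 2 by ring,
    show 6 * ((r - 2) / 4) = 3 * (r - 2) / 2 by ring, ENNReal.ofReal_mul (by positivity),
    ← ENNReal.ofReal_rpow_of_nonneg hL (by linarith),
    ← ENNReal.ofReal_rpow_of_nonneg hS (by linarith)]
  gcongr

/-- The Gagliardo–Nirenberg inequality, for the exponent `p / σ`. -/
theorem exists_gagliardoNirenberg {p σ : ℝ} (hσ : 0 < σ) (h1 : 2 * σ < p) (h2 : p < 6 * σ) :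
    ∃ C : ℝ, 0 ≤ C ∧ ∀ φ : R3 → ℂ, MemH1 φ →
      (∫⁻ x, (‖φ x‖ₑ ^ p) ^ (1 / σ)) ^ σ ≤ ENNReal.ofReal
        (C * (normD12 φ ^ (3 * p / 2 - 3 * σ) * normL2 φ ^ (3 * σ - p / 2))) := by
  obtain ⟨C, hC, hS⟩ := exists_sobolev
  refine ⟨C.toReal ^ (3 * p / 2 - 3 * σ), by positivity, ?_⟩
  rintro φ ⟨hφ, g, hw, hg⟩
  have hD : 0 ≤ normL2 g := ENNReal.toReal_nonneg
  have hL : 0 ≤ normL2 φ := ENNReal.toReal_nonneg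
  have h6 : eLpNorm φ 6 volume ≤ ENNReal.ofReal (C.toReal * normL2 g) := by
    rw [ENNReal.ofReal_mul (by positivity), ENNReal.ofReal_toReal hC, normL2,
      ENNReal.ofReal_toReal hg.2.ne]
    exact hS φ g hφ hw hg.1
  have h2' : eLpNorm φ 2 volume ≤ ENNReal.ofReal (normL2 φ) := by
    rw [normL2, ENNReal.ofReal_toReal hφ.2.ne]
  have key := lintegral_rpow_le_of_eLpNorm_six_le hφ.1 (r := p / σ) (by positivity) hL
    (by rwa [lt_div_iff₀ hσ]) (by rwa [div_lt_iff₀ hσ]) h2' h6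
  simp_rw [← ENNReal.rpow_mul, mul_one_div]
  rw [hw.normD12_eq]
  calc _ ≤ _ := ENNReal.rpow_le_rpow key hσ.le
    _ = _ := by
      rw [ENNReal.ofReal_rpow_of_nonneg (by positivity) hσ.le,
        Real.mul_rpow (by positivity) (by positivity), ← Real.rpow_mul hL,
        ← Real.rpow_mul (by positivity),
        show (6 - p / σ) / 2 * σ = 3 * σ - p / 2 by field_simp; ring,
        show 3 * (p / σ - 2) / 2 * σ = 3 * p / 2 - 3 * σ by field_simp,
        Real.mul_rpow (by positivity) hD]
      congr 1; ring

/-! ### Lebesgue norms of the Green function -/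

/-- Reduces every norm of 𝒢_λ to λ = 1 and a power of λ. At the origin both sides are 0 by the
convention for division by zero. -/
theorem greenFn_eq_smul {lam : ℝ} (h : 0 < lam) (x : R3) :
    greenFn lam x = √lam * greenFn 1 (√lam • x) := by
  have hs : 0 < √lam := Real.sqrt_pos.2 h
  have e : 1 / (4 * Real.pi * ‖x‖) = √lam * (1 / (4 * Real.pi * (√lam * ‖x‖))) := by
    rcases eq_or_ne (‖x‖) 0 with h0 | h0
    · simp [h0]
    · field_simp
  simp only [greenFn, norm_smul, Real.norm_of_nonneg hs.le, Real.sqrt_one]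
  rw [e]
  ring_nf

theorem measurable_greenFn (lam : ℝ) : Measurable (greenFn lam) := by
  unfold greenFn; fun_prop

theorem greenFn_nonneg (lam : ℝ) (x : R3) : 0 ≤ greenFn lam x := by
  unfold greenFn; positivity

/-- Only the singularity |x|^(-r) at the origin restricts r from above; the exponential takes care
of infinity. -/
theorem lintegral_greenFn_one_ne_top {r : ℝ} (hr0 : 0 < r) (hr : r < 3) :
    ∫⁻ x, ENNReal.ofReal (greenFn 1 x) ^ r ≠ ⊤ := by
  have := lintegral_radial_ne_top
    (h := fun s => (1 / (4 * Real.pi * s) * Real.exp (-s)) ^ r) ?_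
  · convert this using 3 with x
    rw [ENNReal.ofReal_rpow_of_nonneg (greenFn_nonneg 1 x) hr0.le]
    simp [greenFn]
  · have h2 := (integrableOn_rpow_mul_exp_neg_mul_rpow (p := 1) (s := 2 - r) (b := r)
      (by linarith) one_pos hr0).const_mul ((1 / (4 * Real.pi)) ^ r)
    refine IntegrableOn.congr_fun h2 (fun s hs => ?_) measurableSet_Ioi
    have hs : 0 < s := hs
    simp only [Real.rpow_one]
    rw [Real.mul_rpow (by positivity) (by positivity), ← Real.exp_mul,
      show 1 / (4 * Real.pi * s) = 1 / (4 * Real.pi) * s⁻¹ by field_simp,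
      Real.mul_rpow (by positivity) (by positivity), Real.inv_rpow hs.le, sub_eq_add_neg,
      Real.rpow_add hs, Real.rpow_ofNat, Real.rpow_neg hs.le]
    ring_nf

/-- The Lebesgue norms of `𝒢_lam`, for the exponent `p / σ`. -/
theorem exists_lintegral_greenFn {p σ : ℝ} (hp : 0 < p) (hσ : 0 < σ) (h : p < 3 * σ) :
    ∃ C : ℝ, 0 ≤ C ∧ ∀ lam : ℝ, 0 < lam →
      (∫⁻ x, (‖(greenFn lam x : ℂ)‖ₑ ^ p) ^ (1 / σ)) ^ σ ≤
        ENNReal.ofReal (C * lam ^ ((p - 3 * σ) / 2)) := by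
  set r := p / σ with hr
  have hr0 : 0 < r := by positivity
  set κ := ∫⁻ x, ENNReal.ofReal (greenFn 1 x) ^ r
  have hκ : κ ≠ ⊤ := lintegral_greenFn_one_ne_top hr0 (by rw [hr, div_lt_iff₀ hσ]; exact h)
  refine ⟨κ.toReal ^ σ, by positivity, fun lam hl => le_of_eq ?_⟩
  have hs : 0 < √lam := Real.sqrt_pos.2 hl
  have hm : Measurable fun x => ENNReal.ofReal (greenFn 1 x) ^ r :=
    (measurable_greenFn 1).ennreal_ofReal.pow_const r
  have e : ∀ x, (‖(greenFn lam x : ℂ)‖ₑ ^ p) ^ (1 / σ) =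
      ENNReal.ofReal (√lam ^ r) * ENNReal.ofReal (greenFn 1 (√lam • x)) ^ r := by
    intro x
    rw [← ENNReal.rpow_mul, mul_one_div, ← ofReal_norm, Complex.norm_real,
      Real.norm_of_nonneg (greenFn_nonneg _ _), greenFn_eq_smul hl, ENNReal.ofReal_mul hs.le,
      ENNReal.mul_rpow_of_nonneg _ _ hr0.le, ENNReal.ofReal_rpow_of_pos hs]
  have hm' : Measurable fun x => ENNReal.ofReal (greenFn 1 (√lam • x)) ^ r :=
    hm.comp (measurable_const_smul _)
  simp_rw [e]
  rw [lintegral_const_mul _ hm',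
    lintegral_comp_smul_R3 (fun x => ENNReal.ofReal (greenFn 1 x) ^ r) hm hs, ← mul_assoc,
    ← ENNReal.ofReal_mul (by positivity), ← Real.rpow_add hs, ENNReal.mul_rpow_of_nonneg _ _ hσ.le,
    ENNReal.ofReal_rpow_of_pos (by positivity), ← Real.rpow_mul hs.le, mul_comm,
    ENNReal.ofReal_mul (by positivity), ← ENNReal.ofReal_rpow_of_nonneg (by positivity) hσ.le,
    ENNReal.ofReal_toReal hκ, Real.sqrt_eq_rpow, ← Real.rpow_mul hl.le]
  congr 3
  rw [hr]; field_simp; ring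

/-! ### Reduction of N(u) to the Riesz form -/

theorem enorm_add_rpow_le {F : Type*} [NormedAddCommGroup F] (a b : F) {p : ℝ} (hp : 0 ≤ p) :
    ‖a + b‖ₑ ^ p ≤ 2 ^ p * (‖a‖ₑ ^ p + ‖b‖ₑ ^ p) := by
  calc ‖a + b‖ₑ ^ p ≤ (2 * max ‖a‖ₑ ‖b‖ₑ) ^ p := by
        gcongr
        refine (enorm_add_le a b).trans ?_
        rw [two_mul]
        exact add_le_add (le_max_left _ _) (le_max_right _ _)
    _ = 2 ^ p * max (‖a‖ₑ ^ p) (‖b‖ₑ ^ p) := by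
        rw [ENNReal.mul_rpow_of_nonneg _ _ hp, (ENNReal.monotone_rpow_of_nonneg hp).map_max]
    _ ≤ _ := by gcongr; exact max_le (le_add_right le_rfl) (le_add_left le_rfl)

theorem add_rpow_le_two_rpow_mul {a b s : ℝ} (ha : 0 ≤ a) (hb : 0 ≤ b) (hs : 0 ≤ s) :
    (a + b) ^ s ≤ 2 ^ s * (a ^ s + b ^ s) := by
  calc (a + b) ^ s ≤ (2 * max a b) ^ s := by
        gcongr
        rw [two_mul]
        exact add_le_add (le_max_left _ _) (le_max_right _ _)
    _ = 2 ^ s * max a b ^ s := Real.mul_rpow (by norm_num) (le_max_of_le_left ha)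
    _ ≤ _ := by
        gcongr
        rcases max_choice a b with h | h <;> rw [h]
        · exact le_add_of_nonneg_right (by positivity)
        · exact le_add_of_nonneg_left (by positivity)

theorem exists_lintegral_smul_greenFn {p σ : ℝ} (hp : 0 < p) (hσ : 0 < σ) (h : p < 3 * σ) :
    ∃ C : ℝ, 0 ≤ C ∧ ∀ (q : ℂ) (lam : ℝ), 0 < lam →
      (∫⁻ x, (‖q * (greenFn lam x : ℂ)‖ₑ ^ p) ^ (1 / σ)) ^ σ ≤
        ENNReal.ofReal (C * (‖q‖ ^ p * lam ^ ((p - 3 * σ) / 2))) := by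
  obtain ⟨C, hC, hG⟩ := exists_lintegral_greenFn hp hσ h
  refine ⟨C, hC, fun q lam hl => ?_⟩
  have hm : Measurable fun x => (‖(greenFn lam x : ℂ)‖ₑ ^ p) ^ (1 / σ) :=
    (((Complex.measurable_ofReal.comp (measurable_greenFn lam)).enorm).pow_const _).pow_const _
  simp_rw [enorm_mul, ENNReal.mul_rpow_of_nonneg _ _ hp.le,
    ENNReal.mul_rpow_of_nonneg _ _ (by positivity : 0 ≤ 1 / σ)]
  rw [lintegral_const_mul _ hm, ENNReal.mul_rpow_of_nonneg _ _ hσ.le, ← ENNReal.rpow_mul (_ ^ p),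
    one_div_mul_cancel hσ.ne', ENNReal.rpow_one,
    show C * (‖q‖ ^ p * lam ^ ((p - 3 * σ) / 2)) = ‖q‖ ^ p * (C * lam ^ ((p - 3 * σ) / 2)) by ring,
    ENNReal.ofReal_mul (by positivity), ← ENNReal.ofReal_rpow_of_nonneg (norm_nonneg _) hp.le,
    ofReal_norm]
  gcongr
  exact hG lam hl

/-- The bilinear form with kernel `|x - y|^(-b)`. -/
noncomputable def rieszForm (b : ℝ) (f g : R3 → ℝ≥0∞) : ℝ≥0∞ :=
  ∫⁻ x, (∫⁻ y, ENNReal.ofReal (1 / ‖x - y‖ ^ b) * f y) * g x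

theorem measurable_rieszKernel_mul (b : ℝ) {f : R3 → ℝ≥0∞} (hf : Measurable f) (x : R3) :
    Measurable fun y => ENNReal.ofReal (1 / ‖x - y‖ ^ b) * f y := by fun_prop

theorem measurable_rieszForm_integrand (b : ℝ) {f g : R3 → ℝ≥0∞} (hf : Measurable f)
    (hg : Measurable g) :
    Measurable fun x => (∫⁻ y, ENNReal.ofReal (1 / ‖x - y‖ ^ b) * f y) * g x := by
  have hm : Measurable fun z : R3 × R3 => ENNReal.ofReal (1 / ‖z.1 - z.2‖ ^ b) * f z.2 := by
    fun_prop
  exact hm.lintegral_prod_right'.mul hg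

theorem rieszForm_add_left (b : ℝ) {f₁ f₂ g : R3 → ℝ≥0∞} (h₁ : Measurable f₁) (hg : Measurable g) :
    rieszForm b (f₁ + f₂) g = rieszForm b f₁ g + rieszForm b f₂ g := by
  unfold rieszForm
  rw [← lintegral_add_left (measurable_rieszForm_integrand b h₁ hg)]
  refine lintegral_congr fun x => ?_
  simp_rw [Pi.add_apply, mul_add]
  rw [lintegral_add_left (measurable_rieszKernel_mul b h₁ x), add_mul]

theorem rieszForm_add_right (b : ℝ) {f g₁ g₂ : R3 → ℝ≥0∞} (hf : Measurable f)
    (h₁ : Measurable g₁) :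
    rieszForm b f (g₁ + g₂) = rieszForm b f g₁ + rieszForm b f g₂ := by
  unfold rieszForm
  rw [← lintegral_add_left (measurable_rieszForm_integrand b hf h₁)]
  simp_rw [Pi.add_apply, mul_add]

/-- Since u is not assumed measurable and is known only up to null sets, additivity of the integral
is used on a measurable majorant instead. -/
theorem nonlocalN_le_rieszForm {β p : ℝ} (hβ0 : 0 < β) (hβ3 : β < 3) (hp : 0 ≤ p) {u : R3 → ℂ}
    {h : R3 → ℝ≥0∞} (hh : Measurable h) (c : ℝ≥0∞) (huh : ∀ᵐ x, ‖u x‖ₑ ^ p ≤ c * h x) :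
    nonlocalN β p u ≤ ENNReal.ofReal
      (1 / (Real.Gamma (β / 2) * Real.pi ^ ((3 : ℝ) / 2) * (2 : ℝ) ^ β) * Real.Gamma ((3 - β) / 2)) *
        c ^ 2 * rieszForm (3 - β) h h := by
  set c₀ := 1 / (Real.Gamma (β / 2) * Real.pi ^ ((3 : ℝ) / 2) * (2 : ℝ) ^ β) *
    Real.Gamma ((3 - β) / 2) with hc₀
  have hc₀0 : 0 ≤ c₀ := by
    have h1 := Real.Gamma_pos_of_pos (by linarith : 0 < β / 2)
    have h2 := Real.Gamma_pos_of_pos (by linarith : 0 < (3 - β) / 2)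
    positivity
  have hu : ∀ x, ENNReal.ofReal (‖u x‖ ^ p) = ‖u x‖ₑ ^ p := fun x => by
    rw [← ENNReal.ofReal_rpow_of_nonneg (norm_nonneg _) hp, ofReal_norm]
  have hk : ∀ x, ENNReal.ofReal (rieszPotential β x) =
      ENNReal.ofReal c₀ * ENNReal.ofReal (1 / ‖x‖ ^ (3 - β)) := fun x => by
    rw [rieszPotential, ← hc₀, ENNReal.ofReal_mul hc₀0]
  unfold nonlocalN rieszForm
  simp_rw [hu, hk]
  rw [← lintegral_const_mul _ (measurable_rieszForm_integrand (3 - β) hh hh)]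
  refine lintegral_mono_ae ?_
  filter_upwards [huh] with x hx
  calc _ ≤ (∫⁻ y, ENNReal.ofReal c₀ * c * (ENNReal.ofReal (1 / ‖x - y‖ ^ (3 - β)) * h y)) *
        (c * h x) := by
        gcongr ?_ * ?_
        refine lintegral_mono_ae ?_
        filter_upwards [huh] with y hy
        calc _ ≤ ENNReal.ofReal c₀ * ENNReal.ofReal (1 / ‖x - y‖ ^ (3 - β)) * (c * h y) := by
              gcongr
          _ = _ := by ring
    _ = _ := by
        rw [lintegral_const_mul _ (measurable_rieszKernel_mul (3 - β) hh x)]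
        ring

/-- Separates the bounds for the two entries, so that the same four numbers serve all the terms of
the expanded form. -/
theorem exists_rieszForm_le {b ε : ℝ} (hb0 : 0 < b) (hε : 0 < ε) (hε1 : b / 3 + 2 * ε ≤ 1)
    (hε2 : 2 * ε < b / 3) {σ₁ σ₂ : ℝ} (hσ₁ : σ₁ = 1 - b / 6 - ε) (hσ₂ : σ₂ = 1 - b / 6 + ε) :
    ∃ C : ℝ, 0 ≤ C ∧ ∀ f g : R3 → ℝ≥0∞, Measurable f → Measurable g → ∀ s₁ s₂ t₁ t₂ : ℝ,
      0 ≤ s₁ → 0 ≤ s₂ → 0 ≤ t₁ → 0 ≤ t₂ →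
      (∫⁻ x, f x ^ (1 / σ₁)) ^ σ₁ ≤ ENNReal.ofReal s₁ →
      (∫⁻ x, f x ^ (1 / σ₂)) ^ σ₂ ≤ ENNReal.ofReal s₂ →
      (∫⁻ x, g x ^ (1 / σ₁)) ^ σ₁ ≤ ENNReal.ofReal t₁ →
      (∫⁻ x, g x ^ (1 / σ₂)) ^ σ₂ ≤ ENNReal.ofReal t₂ →
      rieszForm b f g ≤ ENNReal.ofReal (C * (√(s₁ * s₂) * √(t₁ * t₂))) := by
  obtain ⟨C, hC, h⟩ := exists_riesz_bilinear_le hb0 hε hε1 hε2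
  rw [← hσ₁, ← hσ₂] at h
  refine ⟨C, hC, fun f g hf hg s₁ s₂ t₁ t₂ hs₁ hs₂ ht₁ ht₂ f₁ f₂ g₁ g₂ => ?_⟩
  have := h f g hf hg (s₁ * t₁) (s₂ * t₂) (by positivity) (by positivity)
    (by rw [ENNReal.ofReal_mul hs₁]; gcongr) (by rw [ENNReal.ofReal_mul hs₂]; gcongr)
  rwa [show s₁ * t₁ * (s₂ * t₂) = (s₁ * s₂) * (t₁ * t₂) by ring,
    Real.sqrt_mul (by positivity)] at this

theorem sq_add_mul_le {a b x y : ℝ} (ha : 0 ≤ a) (hb : 0 ≤ b) (hx : 0 ≤ x) (hy : 0 ≤ y) :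
    (a * x + b * y) ^ 2 ≤ 2 * (a + b) ^ 2 * (x ^ 2 + x * y + y ^ 2) := by
  have h1 : a * x + b * y ≤ (a + b) * (x + y) := by
    linarith [mul_nonneg ha hy, mul_nonneg hb hx, add_mul a b (x + y), mul_add a x y, mul_add b x y]
  calc _ ≤ ((a + b) * (x + y)) ^ 2 := by gcongr
    _ = (a + b) ^ 2 * (x + y) ^ 2 := by ring
    _ ≤ (a + b) ^ 2 * (2 * (x ^ 2 + x * y + y ^ 2)) := by
        gcongr; linarith [sq_nonneg x, sq_nonneg y, add_sq x y]
    _ = _ := by ring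

/-! ### The bound in terms of φ -/

set_option maxHeartbeats 400000 in
/-- The bound for `N(u)` in terms of the `L²` norms of `φ` and `∇φ`. -/
theorem exists_nonlocalN_le {β p : ℝ} (hβ0 : 0 < β) (hβ3 : β < 3)
    (hp1 : (3 + β) / 3 < p) (hp2 : p < (3 + β) / 2) :
    ∃ K : ℝ, 0 < K ∧ ∀ (u φ : R3 → ℂ) (q : ℂ) (lam : ℝ), MemH1 φ → 0 < lam →
      u =ᵐ[volume] (fun x => φ x + q * (greenFn lam x : ℂ)) →
      nonlocalN β p u ≤ ENNReal.ofReal (K *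
          (normD12 φ ^ (3 * p - (3 + β)) * normL2 φ ^ (3 + β - p)
            + normD12 φ ^ ((3 * p - (3 + β)) / 2) * normL2 φ ^ ((3 + β - p) / 2) *
                (‖q‖ ^ p / lam ^ ((3 + β - 2 * p) / 4))
            + ‖q‖ ^ (2 * p) / lam ^ ((3 + β - 2 * p) / 2))) := by
  have hp0 : 0 < p := by linarith
  -- In order, the four constraints give: the near exponent α₁ ≤ 1 in Young's inequality, the far
  -- exponent α₂ > 0, p < 3σ₁ for the Green function, and 2σ₂ < p for the interpolation.
  obtain ⟨ε, hε, hεlt⟩ := exists_between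
    (show 0 < min (min (β / 6) ((3 - β) / 6)) (min ((3 + β - 2 * p) / 6) ((3 * p - 3 - β) / 6)) by
      simp only [lt_min_iff]; refine ⟨⟨?_, ?_⟩, ?_, ?_⟩ <;> linarith)
  simp only [lt_min_iff] at hεlt
  obtain ⟨⟨e1, e2⟩, e3, e4⟩ := hεlt
  obtain ⟨σ₁, hσ₁⟩ : ∃ σ, σ = (3 + β) / 6 - ε := ⟨_, rfl⟩
  obtain ⟨σ₂, hσ₂⟩ : ∃ σ, σ = (3 + β) / 6 + ε := ⟨_, rfl⟩
  obtain ⟨C, hC, hR⟩ := exists_rieszForm_le (b := 3 - β) (ε := ε) (σ₁ := σ₁) (σ₂ := σ₂)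
    (by linarith) hε (by linarith) (by linarith) (by rw [hσ₁]; ring) (by rw [hσ₂]; ring)
  obtain ⟨C₁, hC₁, hφ₁⟩ := exists_gagliardoNirenberg (p := p) (σ := σ₁)
    (by linarith) (by linarith) (by linarith)
  obtain ⟨C₂, hC₂, hφ₂⟩ := exists_gagliardoNirenberg (p := p) (σ := σ₂)
    (by linarith) (by linarith) (by linarith)
  obtain ⟨C₃, hC₃, hG₁⟩ := exists_lintegral_smul_greenFn (p := p) (σ := σ₁) hp0
    (by linarith) (by linarith)
  obtain ⟨C₄, hC₄, hG₂⟩ := exists_lintegral_smul_greenFn (p := p) (σ := σ₂) hp0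
    (by linarith) (by linarith)
  set c₀ := 1 / (Real.Gamma (β / 2) * Real.pi ^ ((3 : ℝ) / 2) * (2 : ℝ) ^ β) *
    Real.Gamma ((3 - β) / 2) with hc₀
  have hc₀0 : 0 ≤ c₀ := by
    have h1 := Real.Gamma_pos_of_pos (by linarith : 0 < β / 2)
    have h2 := Real.Gamma_pos_of_pos (by linarith : 0 < (3 - β) / 2)
    positivity
  set a := √(C₁ * C₂)
  set a' := √(C₃ * C₄)
  have ha : 0 ≤ a := Real.sqrt_nonneg _
  have ha' : 0 ≤ a' := Real.sqrt_nonneg _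
  -- The summand 1 secures K > 0, since the other factors are only known to be nonnegative.
  refine ⟨c₀ * (2 ^ p) ^ 2 * C * (2 * (a + a') ^ 2) + 1, by positivity,
    fun u φ q lam hφ hl hu => ?_⟩
  have hD : 0 ≤ normD12 φ := ENNReal.toReal_nonneg
  have hL : 0 ≤ normL2 φ := ENNReal.toReal_nonneg
  set D := normD12 φ
  set L := normL2 φ
  set T := D ^ ((3 * p - (3 + β)) / 2) * L ^ ((3 + β - p) / 2) with hT
  set U := ‖q‖ ^ p / lam ^ ((3 + β - 2 * p) / 4) with hU
  have hT0 : 0 ≤ T := by positivity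
  have hU0 : 0 ≤ U := by positivity
  have sq_rpow : ∀ {x : ℝ} (s : ℝ), 0 ≤ x → (x ^ (s / 2)) ^ 2 = x ^ s := fun {x} s hx => by
    rw [← Real.rpow_natCast, ← Real.rpow_mul hx]; congr 1; push_cast; ring
  have hTT : D ^ (3 * p - (3 + β)) * L ^ (3 + β - p) = T ^ 2 := by
    rw [hT, mul_pow, sq_rpow _ hD, sq_rpow _ hL]
  have hUU : ‖q‖ ^ (2 * p) / lam ^ ((3 + β - 2 * p) / 2) = U ^ 2 := by
    rw [hU, div_pow, show (3 + β - 2 * p) / 4 = (3 + β - 2 * p) / 2 / 2 by ring, sq_rpow _ hl.le,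
      show p = 2 * p / 2 by ring, sq_rpow _ (norm_nonneg q), ← show p = 2 * p / 2 by ring]
  rw [hTT, hUU]
  set s₁ := C₁ * (D ^ (3 * p / 2 - 3 * σ₁) * L ^ (3 * σ₁ - p / 2)) with hs₁
  set s₂ := C₂ * (D ^ (3 * p / 2 - 3 * σ₂) * L ^ (3 * σ₂ - p / 2)) with hs₂
  set t₁ := C₃ * (‖q‖ ^ p * lam ^ ((p - 3 * σ₁) / 2)) with ht₁
  set t₂ := C₄ * (‖q‖ ^ p * lam ^ ((p - 3 * σ₂) / 2)) with ht₂
  -- Here ε cancels, because σ₁ + σ₂ = (3 + β)/3. As D or L may be zero, adding exponents requires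
  -- each of them to be nonnegative; for λ > 0 below there is no such restriction.
  have hs : √(s₁ * s₂) = a * T := by
    have h1 : D ^ (3 * p / 2 - 3 * σ₁) * D ^ (3 * p / 2 - 3 * σ₂) = D ^ (3 * p - (3 + β)) := by
      rw [← Real.rpow_add_of_nonneg hD (by linarith) (by linarith), hσ₁, hσ₂]; congr 1; ring
    have h2 : L ^ (3 * σ₁ - p / 2) * L ^ (3 * σ₂ - p / 2) = L ^ (3 + β - p) := by
      rw [← Real.rpow_add_of_nonneg hL (by linarith) (by linarith), hσ₁, hσ₂]; congr 1; ring
    have : s₁ * s₂ = C₁ * C₂ * T ^ 2 := by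
      rw [← hTT, ← h1, ← h2, hs₁, hs₂]; ring
    rw [this, Real.sqrt_mul (by positivity), Real.sqrt_sq hT0]
  have ht : √(t₁ * t₂) = a' * U := by
    have h1 : lam ^ ((p - 3 * σ₁) / 2) * lam ^ ((p - 3 * σ₂) / 2) =
        (lam ^ ((3 + β - 2 * p) / 2))⁻¹ := by
      rw [← Real.rpow_add hl, ← Real.rpow_neg hl.le, hσ₁, hσ₂]; congr 1; ring
    have h2 : ‖q‖ ^ p * ‖q‖ ^ p = ‖q‖ ^ (2 * p) := by
      rw [← Real.rpow_add_of_nonneg (norm_nonneg q) hp0.le hp0.le]; congr 1; ring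
    have : t₁ * t₂ = C₃ * C₄ * U ^ 2 := by
      rw [← hUU, div_eq_mul_inv, ← h1, ← h2, ht₁, ht₂]; ring
    rw [this, Real.sqrt_mul (by positivity), Real.sqrt_sq hU0]
  have hs₁0 : 0 ≤ s₁ := by positivity
  have hs₂0 : 0 ≤ s₂ := by positivity
  have ht₁0 : 0 ≤ t₁ := by positivity
  have ht₂0 : 0 ≤ t₂ := by positivity
  set φ' := hφ.1.1.mk φ
  have hφe : φ =ᵐ[volume] φ' := hφ.1.1.ae_eq_mk
  have hφm : Measurable φ' := hφ.1.1.stronglyMeasurable_mk.measurable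
  let f : R3 → ℝ≥0∞ := fun x => ‖φ' x‖ₑ ^ p
  let g : R3 → ℝ≥0∞ := fun x => ‖q * (greenFn lam x : ℂ)‖ₑ ^ p
  have hf : Measurable f := hφm.enorm.pow_const p
  have hg : Measurable g :=
    ((Complex.measurable_ofReal.comp (measurable_greenFn lam)).const_mul q).enorm.pow_const p
  have hfe : ∀ σ : ℝ, ∫⁻ x, f x ^ (1 / σ) = ∫⁻ x, (‖φ x‖ₑ ^ p) ^ (1 / σ) := fun σ =>
    lintegral_congr_ae (by filter_upwards [hφe] with x hx; simp only [f, hx])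
  have f₁ : (∫⁻ x, f x ^ (1 / σ₁)) ^ σ₁ ≤ ENNReal.ofReal s₁ := by rw [hfe]; exact hφ₁ φ hφ
  have f₂ : (∫⁻ x, f x ^ (1 / σ₂)) ^ σ₂ ≤ ENNReal.ofReal s₂ := by rw [hfe]; exact hφ₂ φ hφ
  have g₁ : (∫⁻ x, g x ^ (1 / σ₁)) ^ σ₁ ≤ ENNReal.ofReal t₁ := hG₁ q lam hl
  have g₂ : (∫⁻ x, g x ^ (1 / σ₂)) ^ σ₂ ≤ ENNReal.ofReal t₂ := hG₂ q lam hl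
  have hff := hR f f hf hf s₁ s₂ s₁ s₂ hs₁0 hs₂0 hs₁0 hs₂0 f₁ f₂ f₁ f₂
  have hfg := hR f g hf hg s₁ s₂ t₁ t₂ hs₁0 hs₂0 ht₁0 ht₂0 f₁ f₂ g₁ g₂
  have hgf := hR g f hg hf t₁ t₂ s₁ s₂ ht₁0 ht₂0 hs₁0 hs₂0 g₁ g₂ f₁ f₂
  have hgg := hR g g hg hg t₁ t₂ t₁ t₂ ht₁0 ht₂0 ht₁0 ht₂0 g₁ g₂ g₁ g₂
  rw [hs] at hff hfg hgf
  rw [ht] at hfg hgf hgg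
  have huh : ∀ᵐ x, ‖u x‖ₑ ^ p ≤ ENNReal.ofReal (2 ^ p) * (f x + g x) := by
    filter_upwards [hu, hφe] with x hx hx'
    rw [hx, hx', ← ENNReal.ofReal_rpow_of_pos two_pos, ENNReal.ofReal_ofNat]
    exact enorm_add_rpow_le _ _ hp0.le
  refine (nonlocalN_le_rieszForm hβ0 hβ3 hp0.le (hf.add hg) _ huh).trans ?_
  rw [← hc₀, rieszForm_add_left _ hf (hf.add hg), rieszForm_add_right _ hf hf,
    rieszForm_add_right _ hg hf, ← ENNReal.ofReal_pow (by positivity),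
    ← ENNReal.ofReal_mul hc₀0]
  calc _ ≤ ENNReal.ofReal (c₀ * (2 ^ p) ^ 2) *
        ((ENNReal.ofReal (C * (a * T * (a * T))) + ENNReal.ofReal (C * (a * T * (a' * U)))) +
        (ENNReal.ofReal (C * (a' * U * (a * T))) + ENNReal.ofReal (C * (a' * U * (a' * U))))) := by
        gcongr
    _ = ENNReal.ofReal (c₀ * (2 ^ p) ^ 2 * (C * (a * T + a' * U) ^ 2)) := by
        rw [← ENNReal.ofReal_add (by positivity) (by positivity),
          ← ENNReal.ofReal_add (by positivity) (by positivity),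
          ← ENNReal.ofReal_add (by positivity) (by positivity), ← ENNReal.ofReal_mul (by positivity)]
        ring_nf
    _ ≤ _ := by
        refine ENNReal.ofReal_le_ofReal ?_
        have key := sq_add_mul_le ha ha' hT0 hU0
        have hE : 0 ≤ T ^ 2 + T * U + U ^ 2 := by positivity
        calc _ ≤ c₀ * (2 ^ p) ^ 2 * (C * (2 * (a + a') ^ 2 * (T ^ 2 + T * U + U ^ 2))) := by gcongr
          _ = c₀ * (2 ^ p) ^ 2 * C * (2 * (a + a') ^ 2) * (T ^ 2 + T * U + U ^ 2) := by ring
          _ ≤ _ := by gcongr; linarith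

/-! ### Passing from the L² norm of φ to that of u -/

/-- The `L²` norm of the regular part in terms of that of `u` and the charge. -/
theorem exists_normL2_le : ∃ γ : ℝ, 1 ≤ γ ∧ ∀ (u φ : R3 → ℂ) (q : ℂ) (lam : ℝ), MemH1 φ →
    0 < lam → u =ᵐ[volume] (fun x => φ x + q * (greenFn lam x : ℂ)) →
    normL2 φ ≤ γ * (normL2 u + ‖q‖ / lam ^ (1 / 4 : ℝ)) := by
  -- For p = 1 and σ = 1/2 this is the L² norm, with λ-exponent (1 - 3/2)/2 = -1/4.
  obtain ⟨C, hC, hG⟩ := exists_lintegral_smul_greenFn (p := 1) (σ := 1 / 2) one_pos (by norm_num)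
    (by norm_num)
  refine ⟨max 1 C, le_max_left _ _, fun u φ q lam hφ hl hu => ?_⟩
  set G : R3 → ℂ := fun x => q * (greenFn lam x : ℂ)
  have hGm : AEStronglyMeasurable G volume :=
    ((Complex.measurable_ofReal.comp (measurable_greenFn lam)).const_mul q).aestronglyMeasurable
  have hG2 : eLpNorm G 2 volume ≤ ENNReal.ofReal (C * (‖q‖ / lam ^ (1 / 4 : ℝ))) := by
    rw [eLpNorm_two_eq]
    have := hG q lam hl
    simp only [ENNReal.rpow_one, one_div_one_div, Real.rpow_one] at this
    rw [show (1 - 3 * (1 / 2 : ℝ)) / 2 = -(1 / 4) by norm_num, Real.rpow_neg hl.le,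
      ← div_eq_mul_inv] at this
    exact this
  have hGL : MemLp G 2 volume := ⟨hGm, hG2.trans_lt ENNReal.ofReal_lt_top⟩
  -- Without this `normL2 u` could be the default value 0 of an infinite norm, and the bound would
  -- be lost.
  have huL : MemLp u 2 volume := (hφ.1.add hGL).ae_eq hu.symm
  have hφe : φ =ᵐ[volume] u - G := by
    filter_upwards [hu] with x hx; simp [hx, G]
  have h1 : eLpNorm φ 2 volume ≤ eLpNorm u 2 volume + eLpNorm G 2 volume := by
    rw [eLpNorm_congr_ae hφe]
    exact eLpNorm_sub_le huL.1 hGm one_le_two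
  have h2 : normL2 φ ≤ normL2 u + C * (‖q‖ / lam ^ (1 / 4 : ℝ)) := by
    unfold normL2
    calc _ ≤ (eLpNorm u 2 volume + eLpNorm G 2 volume).toReal :=
          ENNReal.toReal_mono (ENNReal.add_ne_top.2 ⟨huL.2.ne, hGL.2.ne⟩) h1
      _ = (eLpNorm u 2 volume).toReal + (eLpNorm G 2 volume).toReal :=
          ENNReal.toReal_add huL.2.ne hGL.2.ne
      _ ≤ _ := by
          gcongr
          exact ENNReal.toReal_le_of_le_ofReal (by positivity) hG2
  have hu0 : 0 ≤ normL2 u := ENNReal.toReal_nonneg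
  calc _ ≤ 1 * normL2 u + C * (‖q‖ / lam ^ (1 / 4 : ℝ)) := by rwa [one_mul]
    _ ≤ max 1 C * normL2 u + max 1 C * (‖q‖ / lam ^ (1 / 4 : ℝ)) := by
        gcongr
        · exact le_max_left _ _
        · exact le_max_right _ _
    _ = _ := by ring

/-- Needed for two values of s. With M ≥ 1 the product of the two constants dominates each of them.
-/
theorem exists_normL2_rpow_le {s : ℝ} (hs : 0 < s) :
    ∃ M : ℝ, 1 ≤ M ∧ ∀ (u φ : R3 → ℂ) (q : ℂ) (lam : ℝ), MemH1 φ →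
      0 < lam → u =ᵐ[volume] (fun x => φ x + q * (greenFn lam x : ℂ)) →
      normL2 φ ^ s ≤ M * (normL2 u ^ s + ‖q‖ ^ s / lam ^ (s / 4)) := by
  obtain ⟨γ, hγ, h⟩ := exists_normL2_le
  have h2s : 1 ≤ (2 : ℝ) ^ s := Real.one_le_rpow one_le_two hs.le
  refine ⟨γ ^ s * 2 ^ s, one_le_mul_of_one_le_of_one_le (Real.one_le_rpow hγ hs.le) h2s,
    fun u φ q lam hφ hl hu => ?_⟩
  have hφ0 : 0 ≤ normL2 φ := ENNReal.toReal_nonneg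
  have hu0 : 0 ≤ normL2 u := ENNReal.toReal_nonneg
  calc normL2 φ ^ s ≤ (γ * (normL2 u + ‖q‖ / lam ^ (1 / 4 : ℝ))) ^ s := by
        gcongr; exact h u φ q lam hφ hl hu
    _ = γ ^ s * (normL2 u + ‖q‖ / lam ^ (1 / 4 : ℝ)) ^ s :=
        Real.mul_rpow (by linarith) (by positivity)
    _ ≤ γ ^ s * (2 ^ s * (normL2 u ^ s + (‖q‖ / lam ^ (1 / 4 : ℝ)) ^ s)) := by
        gcongr
        exact add_rpow_le_two_rpow_mul hu0 (by positivity) hs.le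
    _ = _ := by
        rw [Real.div_rpow (norm_nonneg q) (by positivity), ← Real.rpow_mul hl.le, mul_assoc,
          show 1 / 4 * s = s / 4 by ring]

end PointHartree

theorem proposition4p3 (β p : ℝ) (hβ0 : 0 < β) (hβ3 : β < 3)
    (hp1 : (3 + β) / 3 < p) (hp2 : p < (3 + β) / 2) :
    ∃ K : ℝ, 0 < K ∧
      ∀ (u φ : PointHartree.R3 → ℂ) (q : ℂ) (lam : ℝ),
        PointHartree.MemH1 φ → 0 < lam →
        u =ᵐ[volume] (fun x => φ x + q * (PointHartree.greenFn lam x : ℂ)) →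
        PointHartree.nonlocalN β p u ≤ ENNReal.ofReal (K *
          (PointHartree.normD12 φ ^ (3 * p - (3 + β)) *
              PointHartree.normL2 φ ^ (3 + β - p)
            + PointHartree.normD12 φ ^ ((3 * p - (3 + β)) / 2) *
                PointHartree.normL2 φ ^ ((3 + β - p) / 2) *
                (‖q‖ ^ p / lam ^ ((3 + β - 2 * p) / 4))
            + ‖q‖ ^ (2 * p) / lam ^ ((3 + β - 2 * p) / 2)))
        ∧
        PointHartree.nonlocalN β p u ≤ ENNReal.ofReal (K *
          (PointHartree.normD12 φ ^ (3 * p - (3 + β)) *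
              (PointHartree.normL2 u ^ (3 + β - p)
                + ‖q‖ ^ (3 + β - p) / lam ^ ((3 + β - p) / 4))
            + PointHartree.normD12 φ ^ ((3 * p - (3 + β)) / 2) *
                (PointHartree.normL2 u ^ ((3 + β - p) / 2)
                  + ‖q‖ ^ ((3 + β - p) / 2) / lam ^ ((3 + β - p) / 8)) *
                (‖q‖ ^ p / lam ^ ((3 + β - 2 * p) / 4))
            + ‖q‖ ^ (2 * p) / lam ^ ((3 + β - 2 * p) / 2))) := by
  have hs : 0 < 3 + β - p := by linarith
  obtain ⟨K, hK, h⟩ := PointHartree.exists_nonlocalN_le hβ0 hβ3 hp1 hp2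
  obtain ⟨M₁, hM₁, h₁⟩ := PointHartree.exists_normL2_rpow_le hs
  obtain ⟨M₂, hM₂, h₂⟩ := PointHartree.exists_normL2_rpow_le (half_pos hs)
  have hM : 1 ≤ M₁ * M₂ := one_le_mul_of_one_le_of_one_le hM₁ hM₂
  -- One constant for both bounds: the three terms of the second need the factors M₁, M₂ and 1, and
  -- the first bound needs only 1.
  refine ⟨K * (M₁ * M₂), by positivity, fun u φ q lam hφ hl hu => ?_⟩
  have hD : 0 ≤ PointHartree.normD12 φ := ENNReal.toReal_nonneg
  have hL : 0 ≤ PointHartree.normL2 φ := ENNReal.toReal_nonneg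
  have hu0 : 0 ≤ PointHartree.normL2 u := ENNReal.toReal_nonneg
  have hN := h u φ q lam hφ hl hu
  have b₁ := h₁ u φ q lam hφ hl hu
  have b₂ := h₂ u φ q lam hφ hl hu
  rw [show (3 + β - p) / 2 / 4 = (3 + β - p) / 8 by ring] at b₂
  constructor
  · refine hN.trans (ENNReal.ofReal_le_ofReal ?_)
    gcongr
    exact le_mul_of_one_le_right hK.le hM
  · refine hN.trans (ENNReal.ofReal_le_ofReal ?_)
    rw [mul_assoc K]
    refine mul_le_mul_of_nonneg_left ?_ hK.le
    rw [mul_add, mul_add]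
    refine add_le_add (add_le_add ?_ ?_) (le_mul_of_one_le_left (by positivity) hM)
    · rw [mul_left_comm]
      refine mul_le_mul_of_nonneg_left (b₁.trans ?_) (by positivity)
      gcongr
      exact le_mul_of_one_le_right (by linarith) hM₂
    · rw [← mul_assoc]
      refine mul_le_mul_of_nonneg_right ?_ (by positivity)
      rw [mul_left_comm]
      refine mul_le_mul_of_nonneg_left (b₂.trans ?_) (by positivity)
      gcongr
      exact le_mul_of_one_le_left (by linarith) hM₁
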